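/- Let $\Phi=\{\Phi(t)\}_{t\in\mathbb{R}}$ be a real-valued, jointly measurable, mean-square continuous, stationary Gaussian process whose covariance function has an (integrable) spectral density $p:\mathbb{R}\to(0,\infty)$, i.e. $\mathrm{Cov}(\Phi(t),\Phi(0))=\int_{\mathbb{R}}e^{it\lambda}p(\lambda)\,d\lambda$ for all $t\in\mathbb{R}$. Let $\psi\in L^1(\mathbb{R})\cap L^2(\mathbb{R})$ be an analytic mother wavelet: $\widehat\psi(\omega)=\int_{\mathbb{R}}e^{-it\omega}\psi(t)\,dt$ vanishes for all $\omega\le 0$. Assume that $\widehat\psi$ is differentiable on $(0,\infty)$ with $$\sup_{\lambda>1}|\lambda\widehat\psi(\lambda)|<\infty,\qquad \sup_{\lambda>0}|D\widehat\psi(\lambda)|<\infty,\qquad \sup_{\lambda>0}|\lambda D\widehat\psi(\lambda)|<\infty .$$ Let $W_\Phi$ be the analytic wavelet transform of $\Phi$, $$W_\Phi(t,s)=\int_{\mathbb{R}}\Phi(\tau)\,\frac1s\,\overline{\psi\Big(\frac{\tau-t}{s}\Big)}\,d\tau,\qquad t\in\mathbb{R},\ s>0 .$$ Then, almost surely, this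 integral converges absolutely for all $t\in\mathbb{R}$ and $s>0$, and the following hold. (a) If there are constants $\gamma\in(0,2)$ and $C_1>0$ with $p(\lambda)\le C_1|\lambda|^{-(1+\gamma)}$ for all $\lambda\ne0$, then $$\mathbb{P}\Big(\lim_{s\to0+}W_\Phi(t,s)=0\ \text{for all } t\in\mathbb{R}\Big)=1 .$$ (b) Suppose that one of the following two conditions holds: (b1) (long-range dependence) there are $H\in(0,1)$ and a locally bounded function $L:(0,\infty)\to(0,\infty)$, slowly varying at infinity (that is, $L(cr)/L(r)\to1$ as $r\to\infty$ for every $c>0$), such that $p(\lambda)=L(|\lambda|^{-1})|\lambda|^{H-1}$ for all $\lambda\ne0$ in some neighbourhood of the origin; (b2) (short-range dependence) $p$ is bounded and is continuous at the origin. Then $$\mathbb{P}\Big(\lim_{s\to\infty}W_\Phi(t,s)=0\ \text{for all } t\in\mathbb{R}\Big)=1 .$$ -/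

import Mathlib

open MeasureTheory ProbabilityTheory Filter Set
open scoped Topology

noncomputable section

namespace WaveletNoise

/-- The Fourier transform with the convention `ψ̂(ω) = ∫ e^{-i t ω} ψ(t) dt`. -/
def fourierHat (ψ : ℝ → ℂ) (ω : ℝ) : ℂ :=
  ∫ t : ℝ, Complex.exp (-(Complex.I * t * ω)) * ψ t

/-- An analytic mother wavelet: `ψ ∈ L¹(ℝ) ∩ L²(ℝ)` and `ψ̂(ω) = 0` for `ω ≤ 0`. -/
structure IsAnalyticWavelet (ψ : ℝ → ℂ) : Prop where
  integrable : Integrable ψ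
  memLp_two : MemLp ψ 2
  analytic : ∀ ω : ℝ, ω ≤ 0 → fourierHat ψ ω = 0

/-- The integrand of the analytic wavelet transform at time `t` and scale `s`:
`τ ↦ f(τ) s⁻¹ conj ψ((τ - t) / s)`. -/
def awtIntegrand (ψ : ℝ → ℂ) (f : ℝ → ℝ) (t s : ℝ) (τ : ℝ) : ℂ :=
  (f τ : ℂ) * ((1 / s : ℝ) : ℂ) * (starRingEnd ℂ) (ψ ((τ - t) / s))

/-- The analytic wavelet transform `W_f(t,s) = ∫ f(τ) s⁻¹ conj ψ((τ - t) / s) dτ`. -/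
def awt (ψ : ℝ → ℂ) (f : ℝ → ℝ) (t s : ℝ) : ℂ :=
  ∫ τ : ℝ, awtIntegrand ψ f t s τ

/-- The regularity conditions on `ψ̂`: differentiability on `(0,∞)`, and
`sup_{λ>1} |λ ψ̂(λ)| < ∞`, `sup_{λ>0} |Dψ̂(λ)| < ∞`, `sup_{λ>0} |λ Dψ̂(λ)| < ∞`. -/
structure WaveletRegularity (ψ : ℝ → ℂ) : Prop where
  differentiable : DifferentiableOn ℝ (fourierHat ψ) (Ioi 0)
  d01 : ∃ C : ℝ, ∀ x : ℝ, 1 < x → ‖(x : ℂ) * fourierHat ψ x‖ ≤ C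
  d10 : ∃ C : ℝ, ∀ x : ℝ, 0 < x → ‖deriv (fourierHat ψ) x‖ ≤ C
  d11 : ∃ C : ℝ, ∀ x : ℝ, 0 < x → ‖(x : ℂ) * deriv (fourierHat ψ) x‖ ≤ C

/-- Strict stationarity: the finite-dimensional distributions are invariant under time shifts. -/
def IsStationaryProcess {Ω : Type*} [MeasurableSpace Ω] (P : Measure Ω) (Φ : ℝ → Ω → ℝ) : Prop :=
  ∀ (h : ℝ) (I : Finset ℝ),
    IdentDistrib (fun ω => fun t : I => Φ ((t : ℝ) + h) ω) (fun ω => fun t : I => Φ (t : ℝ) ω) P P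

/-- Mean-square continuity: `E|Φ(t') - Φ(t)|² → 0` as `t' → t`. -/
def IsMeanSquareContinuous {Ω : Type*} [MeasurableSpace Ω] (P : Measure Ω)
    (Φ : ℝ → Ω → ℝ) : Prop :=
  ∀ t : ℝ, Tendsto (fun t' : ℝ => eLpNorm (fun ω => Φ t' ω - Φ t ω) 2 P) (𝓝 t) (𝓝 0)

/-- `p : ℝ → (0,∞)` is a spectral density function of the covariance of `Φ`:
`Cov(Φ(t), Φ(0)) = ∫ e^{i t λ} p(λ) dλ`. -/
structure IsSpectralDensity {Ω : Type*} [MeasurableSpace Ω] (P : Measure Ω)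
    (Φ : ℝ → Ω → ℝ) (p : ℝ → ℝ) : Prop where
  pos : ∀ x : ℝ, 0 < p x
  integrable : Integrable p
  cov_eq : ∀ t : ℝ, ((covariance (Φ t) (Φ 0) P : ℝ) : ℂ) =
    ∫ x : ℝ, Complex.exp (Complex.I * t * x) * (p x : ℂ)

/-- The noise: a (jointly measurable) mean-square continuous, stationary, real-valued Gaussian
process whose covariance has the spectral density `p`. -/
structure IsGaussianNoise {Ω : Type*} [MeasurableSpace Ω] (P : Measure Ω)
    (Φ : ℝ → Ω → ℝ) (p : ℝ → ℝ) : Prop where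
  measurable : Measurable (Function.uncurry Φ)
  gaussian : IsGaussianProcess Φ P
  stationary : IsStationaryProcess P Φ
  meanSquareContinuous : IsMeanSquareContinuous P Φ
  spectralDensity : IsSpectralDensity P Φ p

/-- Decay of the spectral density: `p(λ) ≤ C₁ |λ|^{-(1+γ)}` for all `λ ≠ 0`, for some
`γ ∈ (0,2)` and `C₁ > 0`. -/
def SpectralDecay (p : ℝ → ℝ) : Prop :=
  ∃ γ C₁ : ℝ, 0 < γ ∧ γ < 2 ∧ 0 < C₁ ∧ ∀ x : ℝ, x ≠ 0 → p x ≤ C₁ * |x| ^ (-(1 + γ))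

/-- `L : (0,∞) → (0,∞)` is locally bounded and slowly varying at infinity
(only the values of `L` on `(0,∞)` matter). -/
structure IsSlowlyVarying (L : ℝ → ℝ) : Prop where
  pos : ∀ r : ℝ, 0 < r → 0 < L r
  locallyBounded : ∀ K : Set ℝ, K ⊆ Ioi 0 → IsCompact K → ∃ M : ℝ, ∀ r ∈ K, L r ≤ M
  slowly : ∀ c : ℝ, 0 < c → Tendsto (fun r : ℝ => L (c * r) / L r) atTop (𝓝 1)

/-- Long-range dependence: `p(λ) = L(|λ|⁻¹) |λ|^{H-1}` near the origin (off the origin itself). -/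
def LongRangeDependence (p : ℝ → ℝ) : Prop :=
  ∃ (H : ℝ) (L : ℝ → ℝ), 0 < H ∧ H < 1 ∧ IsSlowlyVarying L ∧
    ∀ᶠ x in 𝓝[≠] (0 : ℝ), p x = L (|x|⁻¹) * |x| ^ (H - 1)

/-- Short-range dependence: `p` is bounded and continuous at the origin. -/
def ShortRangeDependence (p : ℝ → ℝ) : Prop :=
  (∃ M : ℝ, ∀ x : ℝ, p x ≤ M) ∧ ContinuousAt p 0

end WaveletNoise

end

/-! Up to complex conjugation, the transform integrates the noise against the atom `waveletAtom ψ t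
s`. Since `ψ̂(0) = 0`, the atom has integral zero, so the noise may be centered.

For the centered noise, the spectral representation (`lintegral_sq_integral`) gives `E|W(t,s)|² = ∫
|ψ̂(s x)|² p(x) dx`, which is independent of `t`. This is `scaleVariance`. It decays like a power of
`s` as `s → 0` when `p` decays at infinity, because `ψ̂` is small near `0`. It decays like a power
of `1/s` as `s → ∞` when `p` puts little mass near `0`, because `ψ̂` is small at infinity. The
integral lies in the closed `L²` span of the Gaussian process, so its moment of order `2k` is at
most a constant times the `k`-th power of the variance (`lintegral_pow_integral_le`). The moments
therefore decay polynomially, as fast as desired.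

The passage to all `t` and `s` at once is pathwise. Almost every path satisfies `∫ (1+|τ|)^(-3/2)
|Φ(τ)|² dτ < ∞`. By Cauchy–Schwarz, absolute convergence and a Hölder modulus of `W` on `|t| ≤ N`,
`1/N ≤ s ≤ N` reduce to estimates of the atoms in `L²((1+|τ|)^(3/2) dτ)`. Those come from
interpolating two bounds. One is a Plancherel bound on differences of atoms, the other a bound with
weight `(1+|τ|)²`, which is finite because `u ψ(u)` is square integrable
(`lintegral_mul_sq_lt_top`).

The modulus loses only a fixed power of `N`, so a polynomially fine grid controls all points
(`ae_forall_tendsto_zero`). A large `k` makes the expected sum of `|W|^(2k)` over all grids finite,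
so the grid values tend to zero almost surely and the modulus fills the gaps. -/

open scoped ENNReal NNReal

/-! ### Plancherel on `L¹ ∩ L²`. -/

namespace WaveletNoise

open FourierTransform SchwartzMap in
/-- On `L¹ ∩ L²` the `L²` Fourier transform is given by the Fourier integral. -/
theorem coeFn_fourier_toLp_ae_eq {f : ℝ → ℂ} (h1 : Integrable f) (h2 : MemLp f 2) :
    (𝓕 (h2.toLp f) : Lp ℂ 2 (volume : Measure ℝ)) =ᵐ[volume] 𝓕 f := by
  have hloc1 : LocallyIntegrable (𝓕 (h2.toLp f) : Lp ℂ 2 (volume : Measure ℝ)) volume :=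
    (Lp.memLp _).locallyIntegrable (by norm_num)
  have hcont : Continuous (𝓕 f) := VectorFourier.fourierIntegral_continuous
    Real.continuous_fourierChar (by exact continuous_inner) h1
  have hloc2 : LocallyIntegrable (𝓕 f) volume := hcont.locallyIntegrable
  refine ae_eq_of_integral_contDiff_smul_eq hloc1 hloc2 fun g hg hgs => ?_
  have hgc : HasCompactSupport (fun x => (g x : ℂ)) :=
    hgs.comp_left (g := fun x : ℝ => (x : ℂ)) (by simp)
  have hgd : ContDiff ℝ (⊤ : ℕ∞) (fun x => (g x : ℂ)) := Complex.ofRealCLM.contDiff.comp hg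
  set G : 𝓢(ℝ, ℂ) := hgc.toSchwartzMap hgd with hG
  have hGg : ∀ x, G x = (g x : ℂ) := fun x => rfl
  -- By the multiplication formula, for tempered distributions on one side and for integrable
  -- functions on the other, both integrals equal `∫ Ĝ f`.
  have key : ∫ x, G x • (𝓕 (h2.toLp f) : Lp ℂ 2 (volume : Measure ℝ)) x
      = ∫ x, G x • 𝓕 f x := by
    rw [← Lp.toTemperedDistribution_apply, ← Lp.fourier_toTemperedDistribution_eq,
      TemperedDistribution.fourier_apply, Lp.toTemperedDistribution_apply]
    have e1 : ∫ x, (𝓕 G) x • (h2.toLp f) x = ∫ x, (𝓕 G) x • f x := by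
      refine integral_congr_ae ?_
      filter_upwards [h2.coeFn_toLp] with x hx
      rw [hx]
    rw [e1]
    rw [SchwartzMap.fourier_coe]
    simpa using! VectorFourier.integral_fourierIntegral_smul_eq_flip (L := innerₗ ℝ)
      Real.continuous_fourierChar continuous_inner G.integrable h1
  simpa [hGg] using key

open FourierTransform in
theorem eLpNorm_fourier_eq {f : ℝ → ℂ} (h1 : Integrable f) (h2 : MemLp f 2) :
    eLpNorm (𝓕 f) 2 volume = eLpNorm f 2 volume := by
  rw [← eLpNorm_congr_ae (coeFn_fourier_toLp_ae_eq h1 h2), ← Lp.enorm_def]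
  have h : ‖(𝓕 (h2.toLp f) : Lp ℂ 2 (volume : Measure ℝ))‖ₑ = ‖h2.toLp f‖ₑ := by
    rw [← ofReal_norm, ← ofReal_norm, Lp.norm_fourier_eq]
  rw [h, Lp.enorm_def]
  exact eLpNorm_congr_ae h2.coeFn_toLp

open FourierTransform in
theorem fourierHat_eq_fourier (f : ℝ → ℂ) (ω : ℝ) :
    fourierHat f ω = 𝓕 f ((2 * Real.pi)⁻¹ * ω) := by
  rw [Real.fourier_eq']
  unfold fourierHat
  congr 1 with t
  rw [smul_eq_mul]
  congr 2
  have : (Real.pi : ℂ) ≠ 0 := by exact_mod_cast Real.pi_ne_zero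
  simp
  field_simp

theorem lintegral_comp_const_mul (f : ℝ → ℝ≥0∞) {a : ℝ} (ha : a ≠ 0) :
    ∫⁻ x, f (a * x) = ENNReal.ofReal |a⁻¹| * ∫⁻ x, f x := by
  have h := lintegral_map_equiv (μ := volume) f (Homeomorph.mulLeft₀ a ha).toMeasurableEquiv
  rw [show ⇑(Homeomorph.mulLeft₀ a ha).toMeasurableEquiv = (a * ·) from rfl,
    Real.map_volume_mul_left ha, lintegral_smul_measure] at h
  exact h.symm

/-- The affine change of variables `τ = t + s u`. -/
theorem lintegral_comp_sub_div (f : ℝ → ℝ≥0∞) (t : ℝ) {s : ℝ} (hs : 0 < s) :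
    ∫⁻ x, f ((x - t) / s) = ENNReal.ofReal s * ∫⁻ x, f x := by
  rw [lintegral_sub_right_eq_self (fun x => f (x / s)) t]
  simp_rw [div_eq_inv_mul]
  rw [lintegral_comp_const_mul f (inv_ne_zero hs.ne'), inv_inv, abs_of_pos hs]

/-- The Plancherel inequality for `fourierHat`. -/
theorem lintegral_sq_le_fourierHat {f : ℝ → ℂ} (h1 : Integrable f) (h2 : MemLp f 2) :
    ∫⁻ x, ‖f x‖ₑ ^ 2 ≤ ∫⁻ x, ‖fourierHat f x‖ₑ ^ 2 := by
  have h := eLpNorm_fourier_eq h1 h2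
  have hp : (2 * Real.pi)⁻¹ ≠ 0 := by positivity
  simp_rw [fourierHat_eq_fourier]
  rw [lintegral_comp_const_mul (fun x => ‖FourierTransform.fourier f x‖ₑ ^ 2) hp]
  have h' : ∫⁻ x, ‖FourierTransform.fourier f x‖ₑ ^ 2 = ∫⁻ x, ‖f x‖ₑ ^ 2 := by
    have e (g : ℝ → ℂ) : ∫⁻ x, ‖g x‖ₑ ^ 2 = eLpNorm g 2 volume ^ 2 := by
      rw [eLpNorm_eq_lintegral_rpow_enorm_toReal (by norm_num) (by norm_num),
        ← ENNReal.rpow_natCast, ← ENNReal.rpow_mul]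
      simp
    rw [e, e, h]
  rw [h', inv_inv, abs_of_pos (by positivity)]
  -- With this normalisation the two sides differ exactly by the factor `2π`; only `1 ≤ 2π` is kept.
  refine le_mul_of_one_le_left (by simp) ?_
  rw [ENNReal.one_le_ofReal]
  linarith [Real.pi_gt_three]

end WaveletNoise

/-! ### Bounds on `ψ̂` and the first moment of `ψ`. -/

namespace WaveletNoise

theorem continuous_fourierHat {f : ℝ → ℂ} (h1 : Integrable f) : Continuous (fourierHat f) := by
  have hcont : Continuous (FourierTransform.fourier f) := VectorFourier.fourierIntegral_continuous
    Real.continuous_fourierChar (by exact continuous_inner) h1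
  have : fourierHat f = fun ω => FourierTransform.fourier f ((2 * Real.pi)⁻¹ * ω) :=
    funext (fourierHat_eq_fourier f)
  rw [this]
  fun_prop

theorem integrable_exp_mul {f : ℝ → ℂ} (h1 : Integrable f) (x : ℝ) :
    Integrable fun t : ℝ => Complex.exp (-(Complex.I * t * x)) * f t := by
  refine h1.bdd_mul (c := 1) (by fun_prop) (ae_of_all _ fun t => ?_)
  rw [show -(Complex.I * t * x) = ((-(t * x) : ℝ) : ℂ) * Complex.I by push_cast; ring,
    Complex.norm_exp_ofReal_mul_I]

theorem norm_fourierHat_le {f : ℝ → ℂ} (x : ℝ) : ‖fourierHat f x‖ ≤ ∫ t, ‖f t‖ := by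
  refine (norm_integral_le_integral_norm _).trans (le_of_eq ?_)
  congr 1 with t
  rw [show -(Complex.I * t * x) = ((-(t * x) : ℝ) : ℂ) * Complex.I by push_cast; ring, norm_mul,
    Complex.norm_exp_ofReal_mul_I, one_mul]

/-- Quantitative bounds on `ψ̂` used throughout. -/
structure HatBounds (ψ : ℝ → ℂ) (C : ℝ) : Prop where
  pos : 0 < C
  decay : ∀ x, ‖fourierHat ψ x‖ ≤ C / (1 + |x|)
  lipschitz : ∀ x y, ‖fourierHat ψ y - fourierHat ψ x‖ ≤ C * |y - x|
  logLipschitz : ∀ x y, 0 < x → x ≤ y → ‖fourierHat ψ y - fourierHat ψ x‖ ≤ C * (y - x) / x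

/-- The mean value inequality turns each derivative bound into a Lipschitz estimate: `|Dψ̂| ≤ C1`
globally, and `|Dψ̂| ≤ C2 / x` on `[x, y]`. The Lipschitz bound crosses the origin because `ψ̂` is
continuous and vanishes on `(-∞, 0]`. -/
theorem exists_hatBounds {ψ : ℝ → ℂ} (hψ : IsAnalyticWavelet ψ) (hreg : WaveletRegularity ψ) :
    ∃ C, HatBounds ψ C := by
  obtain ⟨C0, h0⟩ := hreg.d01
  obtain ⟨C1, h1⟩ := hreg.d10
  obtain ⟨C2, h2⟩ := hreg.d11
  set A := ∫ t, ‖ψ t‖ with hA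
  have hA0 : 0 ≤ A := integral_nonneg fun _ => norm_nonneg _
  have hA' : ∀ x, ‖fourierHat ψ x‖ ≤ A := fun x => norm_fourierHat_le x
  set C := 1 + 2 * A + 2 * |C0| + |C1| + |C2| with hC
  have hdiff : ∀ x, 0 < x → DifferentiableAt ℝ (fourierHat ψ) x := fun x hx =>
    hreg.differentiable.differentiableAt (Ioi_mem_nhds hx)
  have hmv (x y B : ℝ) (hx : 0 < x) (hxy : x ≤ y) (hB : ∀ z, x ≤ z → ‖deriv (fourierHat ψ) z‖ ≤ B) :
      ‖fourierHat ψ y - fourierHat ψ x‖ ≤ B * (y - x) := by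
    have := (convex_Ici x).norm_image_sub_le_of_norm_deriv_le (f := fourierHat ψ) (C := B)
      (fun z hz => hdiff z (hx.trans_le hz)) (fun z hz => hB z hz) (x := x) (y := y)
      (mem_Ici.2 le_rfl) hxy
    rwa [Real.norm_of_nonneg (by linarith)] at this
  have hlip1 (x y : ℝ) (hx : 0 < x) (hxy : x ≤ y) :
      ‖fourierHat ψ y - fourierHat ψ x‖ ≤ |C1| * (y - x) :=
    hmv x y _ hx hxy fun z hz => (h1 z (hx.trans_le hz)).trans (le_abs_self _)
  have hlip0 (y : ℝ) (hy : 0 < y) : ‖fourierHat ψ y‖ ≤ |C1| * y := by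
    have hc := (continuous_fourierHat hψ.integrable).continuousAt (x := (0 : ℝ))
    have ht : Tendsto (fun x => ‖fourierHat ψ y - fourierHat ψ x‖) (𝓝[>] 0)
        (𝓝 ‖fourierHat ψ y - fourierHat ψ 0‖) :=
      ((continuous_const.sub (continuous_fourierHat hψ.integrable)).norm.tendsto 0).mono_left
        nhdsWithin_le_nhds
    rw [hψ.analytic 0 le_rfl, sub_zero] at ht
    refine le_of_tendsto ht ?_
    filter_upwards [Ioo_mem_nhdsGT hy] with x hx
    refine (hlip1 x y hx.1 hx.2.le).trans ?_
    have := hx.1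
    gcongr
    linarith
  have hlip (x y : ℝ) (hxy : x ≤ y) : ‖fourierHat ψ y - fourierHat ψ x‖ ≤ |C1| * (y - x) := by
    rcases lt_or_ge 0 x with hx | hx
    · exact hlip1 x y hx hxy
    rw [hψ.analytic x hx, sub_zero]
    rcases lt_or_ge 0 y with hy | hy
    · refine (hlip0 y hy).trans ?_
      gcongr
      linarith
    · rw [hψ.analytic y hy, norm_zero]
      have : 0 ≤ y - x := by linarith
      positivity
  have hC1 : |C1| ≤ C := by have := abs_nonneg C0; have := abs_nonneg C2; linarith
  have hC2 : |C2| ≤ C := by have := abs_nonneg C0; have := abs_nonneg C1; linarith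
  refine ⟨C, by positivity, fun x => ?_, fun x y => ?_, fun x y hx hxy => ?_⟩
  · rw [le_div_iff₀ (by positivity)]
    have := abs_nonneg C0; have := abs_nonneg C1; have := abs_nonneg C2
    rcases le_or_gt x 1 with hx1 | hx1
    · rcases le_or_gt x 0 with hx0 | hx0
      · rw [hψ.analytic x hx0]; simp; positivity
      · rw [abs_of_pos hx0]
        calc _ ≤ A * (1 + 1) := by gcongr; exact hA' x
          _ ≤ C := by linarith
    · have h := h0 x hx1
      rw [norm_mul, Complex.norm_real, Real.norm_eq_abs] at h
      have h3 := hA' x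
      have := le_abs_self C0
      linarith
  · rcases le_total x y with h | h
    · rw [abs_of_nonneg (by linarith)]
      exact (hlip x y h).trans (by gcongr)
    · rw [norm_sub_rev, abs_sub_comm, abs_of_nonneg (by linarith)]
      exact (hlip y x h).trans (by gcongr)
  · have hh := hmv x y (|C2| / x) hx hxy fun z hz => by
      have hz0 := hx.trans_le hz
      have h := h2 z hz0
      rw [norm_mul, Complex.norm_real, Real.norm_of_nonneg hz0.le] at h
      rw [le_div_iff₀ hx]
      calc _ ≤ ‖deriv (fourierHat ψ) z‖ * z := by gcongr
        _ ≤ C2 := by linarith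
        _ ≤ _ := le_abs_self _
    refine hh.trans ?_
    rw [div_mul_eq_mul_div]
    gcongr

/-- A square-integrable majorant uniform in `h`. It comes from the Lipschitz bound for `|x| ≤ 1` and
the logarithmic one for `x > 1`; for `x < -1` both points are negative since `h ≤ 1`. -/
theorem HatBounds.slope_le {ψ : ℝ → ℂ} {C : ℝ} (hψ : IsAnalyticWavelet ψ) (hC : HatBounds ψ C)
    {h : ℝ} (h0 : 0 < h) (h1 : h ≤ 1) (x : ℝ) :
    ‖(fourierHat ψ (x + h) - fourierHat ψ x) / h‖ ≤ 2 * C / (1 + |x|) := by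
  have hCp := hC.pos
  rw [norm_div, Complex.norm_real, Real.norm_of_nonneg h0.le, div_le_iff₀ h0]
  rcases le_or_gt |x| 1 with hx | hx
  · refine (hC.lipschitz x (x + h)).trans ?_
    rw [add_sub_cancel_left, abs_of_pos h0]
    gcongr
    rw [le_div_iff₀ (by positivity)]
    nlinarith
  · rcases lt_abs.1 hx with hx | hx
    · have hx0 : 0 < x := by linarith
      refine (hC.logLipschitz x (x + h) hx0 (by linarith)).trans ?_
      rw [add_sub_cancel_left, abs_of_pos hx0, div_mul_eq_mul_div, div_le_div_iff₀ hx0 (by linarith)]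
      have : 0 < C * h := by positivity
      nlinarith
    · rw [hψ.analytic _ (by linarith), hψ.analytic _ (by linarith)]
      simp
      positivity

theorem lintegral_one_add_abs_rpow_lt_top {r : ℝ} (hr : 1 < r) :
    ∫⁻ x : ℝ, ENNReal.ofReal ((1 + |x|) ^ (-r)) < ∞ := by
  have h := integrable_one_add_norm (E := ℝ) (μ := volume) (r := r) (by simpa using hr)
  have := h.lintegral_lt_top
  simpa using this

/-- The first moment of an analytic wavelet with the regularity above is square integrable. -/
theorem lintegral_mul_sq_lt_top {ψ : ℝ → ℂ} {C : ℝ} (hψ : IsAnalyticWavelet ψ)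
    (hC : HatBounds ψ C) : ∫⁻ u : ℝ, ‖(u : ℂ) * ψ u‖ₑ ^ 2 < ∞ := by
  set h : ℕ → ℝ := fun n => 1 / ((n : ℝ) + 1) with hh
  have h0 : ∀ n, 0 < h n := fun n => by positivity
  have h1 : ∀ n, h n ≤ 1 := fun n => by
    rw [hh]; simp only; rw [div_le_one (by positivity)]
    have : (0 : ℝ) ≤ n := by positivity
    linarith
  have hlim : Tendsto h atTop (𝓝 0) := tendsto_one_div_add_atTop_nhds_zero_nat
  -- The transform of `f n` is the difference quotient of `ψ̂` with step `h n`, while `f n u`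
  -- converges pointwise to `-i u ψ(u)`. Plancherel and Fatou then bound the first moment without
  -- identifying the transform of `u ψ(u)`.
  set f : ℕ → ℝ → ℂ := fun n u => ((h n : ℂ))⁻¹ * (Complex.exp (-(Complex.I * u * (h n))) - 1) * ψ u
    with hf
  have hform (n : ℕ) : f n = fun u : ℝ => ((h n : ℂ))⁻¹ *
      (Complex.exp (-(Complex.I * u * (h n))) * ψ u - ψ u) := by
    ext u; simp only [hf]; ring
  have hfi (n : ℕ) : Integrable (f n) := by
    rw [hform]
    exact ((integrable_exp_mul hψ.integrable (h n)).sub hψ.integrable).const_mul _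
  have hfm (n : ℕ) : MemLp (f n) 2 := by
    refine MemLp.of_le_mul (c := (h n)⁻¹ * 2) hψ.memLp_two (hfi n).aestronglyMeasurable
      (ae_of_all _ fun u => ?_)
    simp only [hf, norm_mul, norm_inv, Complex.norm_real, Real.norm_of_nonneg (h0 n).le]
    have := h0 n
    gcongr
    refine (norm_sub_le _ _).trans ?_
    rw [show -(Complex.I * u * (h n)) = ((-(u * h n) : ℝ) : ℂ) * Complex.I by push_cast; ring,
      Complex.norm_exp_ofReal_mul_I]
    norm_num
  have hhat (n : ℕ) (x : ℝ) :
      fourierHat (f n) x = (fourierHat ψ (x + h n) - fourierHat ψ x) / h n := by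
    have e : ∀ t : ℝ, Complex.exp (-(Complex.I * t * x)) * f n t = ((h n : ℂ))⁻¹ *
        (Complex.exp (-(Complex.I * t * ((x + h n : ℝ) : ℂ))) * ψ t -
          Complex.exp (-(Complex.I * t * x)) * ψ t) := by
      intro t
      have : Complex.exp (-(Complex.I * t * ((x + h n : ℝ) : ℂ))) =
          Complex.exp (-(Complex.I * t * x)) * Complex.exp (-(Complex.I * t * (h n))) := by
        rw [← Complex.exp_add]; congr 1; push_cast; ring
      rw [this]; simp only [hf]; ring
    unfold fourierHat
    simp_rw [e]
    rw [integral_const_mul, integral_sub (integrable_exp_mul hψ.integrable _)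
      (integrable_exp_mul hψ.integrable _)]
    ring
  have hpt (u : ℝ) : Tendsto (fun n => ‖f n u‖ₑ ^ 2) atTop (𝓝 (‖(u : ℂ) * ψ u‖ₑ ^ 2)) := by
    have hd : HasDerivAt (fun x : ℝ => Complex.exp (-(Complex.I * u * x))) (-(Complex.I * u)) 0 := by
      have h1 : HasDerivAt (fun x : ℝ => -(Complex.I * u * (x : ℂ))) (-(Complex.I * u)) 0 := by
        simpa using (((hasDerivAt_id (0 : ℝ)).ofReal_comp).const_mul (Complex.I * u)).fun_neg
      simpa using h1.cexp
    have h2 := hd.tendsto_slope_zero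
    have h3 : Tendsto h atTop (𝓝[≠] 0) :=
      tendsto_nhdsWithin_iff.2 ⟨hlim, Eventually.of_forall fun n => (h0 n).ne'⟩
    have h4 := ((ENNReal.continuous_pow 2).tendsto _).comp ((h2.comp h3).mul_const (ψ u)).enorm
    have h5 : ‖-(Complex.I * u) * ψ u‖ₑ = ‖(u : ℂ) * ψ u‖ₑ := by
      rw [neg_mul, enorm_neg, mul_assoc, enorm_mul Complex.I, ← ofReal_norm Complex.I]
      simp
    rw [h5] at h4
    refine h4.congr fun n => ?_
    simp [hf]
  calc ∫⁻ u : ℝ, ‖(u : ℂ) * ψ u‖ₑ ^ 2 = ∫⁻ u : ℝ, liminf (fun n => ‖f n u‖ₑ ^ 2) atTop := by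
        congr 1 with u; exact (hpt u).liminf_eq.symm
    _ ≤ liminf (fun n => ∫⁻ u, ‖f n u‖ₑ ^ 2) atTop :=
        lintegral_liminf_le' fun n => (hfi n).aestronglyMeasurable.enorm.pow_const 2
    _ ≤ liminf (fun _ : ℕ => ∫⁻ x : ℝ, ENNReal.ofReal (4 * C ^ 2) *
          ENNReal.ofReal ((1 + |x|) ^ (-2 : ℝ))) atTop := by
        refine liminf_le_liminf (Eventually.of_forall fun n => ?_)
        refine (lintegral_sq_le_fourierHat (hfi n) (hfm n)).trans (lintegral_mono fun x => ?_)
        rw [hhat, ← ofReal_norm, ← ENNReal.ofReal_pow (norm_nonneg _),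
          ← ENNReal.ofReal_mul (by positivity)]
        refine ENNReal.ofReal_le_ofReal ?_
        have hs := hC.slope_le hψ (h0 n) (h1 n) x
        calc _ ≤ (2 * C / (1 + |x|)) ^ 2 := by gcongr
          _ = _ := by
            rw [Real.rpow_neg (by positivity), div_pow]
            norm_cast
            ring
    _ < ∞ := by
        rw [liminf_const, lintegral_const_mul' _ _ ENNReal.ofReal_ne_top]
        exact ENNReal.mul_lt_top ENNReal.ofReal_lt_top
          (lintegral_one_add_abs_rpow_lt_top (by norm_num))

end WaveletNoise

/-! ### Wavelet atoms and their modulus of continuity in `L²`. -/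

namespace WaveletNoise

/-- The wavelet `ψ` translated to time `t` and dilated to scale `s`. -/
noncomputable def waveletAtom (ψ : ℝ → ℂ) (t s τ : ℝ) : ℂ :=
  ((1 / s : ℝ) : ℂ) * ψ ((τ - t) / s)

theorem awtIntegrand_eq (ψ : ℝ → ℂ) (f : ℝ → ℝ) (t s τ : ℝ) :
    awtIntegrand ψ f t s τ = (f τ : ℂ) * (starRingEnd ℂ) (waveletAtom ψ t s τ) := by
  simp [awtIntegrand, waveletAtom, mul_assoc]

theorem integrable_waveletAtom {ψ : ℝ → ℂ} (hψ : Integrable ψ) (t : ℝ) {s : ℝ} (hs : 0 < s) :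
    Integrable (waveletAtom ψ t s) :=
  ((hψ.comp_div hs.ne').comp_sub_right t).const_mul _

theorem lintegral_enorm_waveletAtom (ψ : ℝ → ℂ) (t : ℝ) {s : ℝ} (hs : 0 < s) (g : ℝ → ℝ≥0∞) :
    ∫⁻ τ, g τ * ‖waveletAtom ψ t s τ‖ₑ ^ 2 =
      ENNReal.ofReal s⁻¹ * ∫⁻ u, g (t + s * u) * ‖ψ u‖ₑ ^ 2 := by
  have h := lintegral_comp_sub_div (fun u => g (t + s * u) * ‖ψ u‖ₑ ^ 2) t hs
  have e : ∀ τ, g τ * ‖waveletAtom ψ t s τ‖ₑ ^ 2 = ENNReal.ofReal (s⁻¹ ^ 2) *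
      (g (t + s * ((τ - t) / s)) * ‖ψ ((τ - t) / s)‖ₑ ^ 2) := by
    intro τ
    rw [mul_div_cancel₀ _ hs.ne', add_sub_cancel, waveletAtom, enorm_mul, mul_pow,
      ← ofReal_norm ((1 / s : ℝ) : ℂ), Complex.norm_real, Real.norm_of_nonneg (by positivity),
      ENNReal.ofReal_pow (by positivity), one_div]
    ring
  simp_rw [e]
  rw [lintegral_const_mul' _ _ ENNReal.ofReal_ne_top, h, ← mul_assoc,
    ← ENNReal.ofReal_mul (by positivity)]
  congr 2
  field_simp

theorem memLp_waveletAtom {ψ : ℝ → ℂ} (hψ : IsAnalyticWavelet ψ) (t : ℝ) {s : ℝ} (hs : 0 < s) :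
    MemLp (waveletAtom ψ t s) 2 := by
  refine ⟨(integrable_waveletAtom hψ.integrable t hs).aestronglyMeasurable, ?_⟩
  have h2 := hψ.memLp_two.2
  rw [eLpNorm_lt_top_iff_lintegral_rpow_enorm_lt_top (by norm_num) (by norm_num)] at h2 ⊢
  have := lintegral_enorm_waveletAtom ψ t hs (fun _ => 1)
  simp only [one_mul] at this
  simp only [ENNReal.toReal_ofNat, ENNReal.rpow_ofNat] at h2 ⊢
  rw [this]
  exact ENNReal.mul_lt_top ENNReal.ofReal_lt_top h2

theorem fourierHat_waveletAtom (ψ : ℝ → ℂ) (t : ℝ) {s : ℝ} (hs : 0 < s) (x : ℝ) :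
    fourierHat (waveletAtom ψ t s) x =
      Complex.exp (-(Complex.I * t * x)) * fourierHat ψ (s * x) := by
  have hs' : (s : ℂ) ≠ 0 := by exact_mod_cast hs.ne'
  have e : ∀ τ : ℝ, Complex.exp (-(Complex.I * τ * x)) * waveletAtom ψ t s τ =
      (fun y : ℝ => Complex.exp (-(Complex.I * t * x)) * ((s : ℂ)⁻¹ *
        (Complex.exp (-(Complex.I * (y / s : ℝ) * (s * x : ℝ))) * ψ (y / s)))) (τ - t) := by
    intro τ
    have : Complex.exp (-(Complex.I * τ * x)) = Complex.exp (-(Complex.I * t * x)) *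
        Complex.exp (-(Complex.I * ((τ - t) / s : ℝ) * (s * x : ℝ))) := by
      rw [← Complex.exp_add]; congr 1; push_cast; field_simp; ring
    simp only [this, waveletAtom]
    push_cast
    ring
  unfold fourierHat
  simp_rw [e]
  rw [integral_sub_right_eq_self (fun y : ℝ => Complex.exp (-(Complex.I * t * x)) * ((s : ℂ)⁻¹ *
        (Complex.exp (-(Complex.I * (y / s : ℝ) * (s * x : ℝ))) * ψ (y / s)))) t,
    integral_const_mul, integral_const_mul,
    Measure.integral_comp_div (fun y : ℝ => Complex.exp (-(Complex.I * y * (s * x : ℝ))) * ψ y) s,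
    abs_of_pos hs, Complex.real_smul, inv_mul_cancel_left₀ hs']

theorem fourierHat_sub {f g : ℝ → ℂ} (hf : Integrable f) (hg : Integrable g) (x : ℝ) :
    fourierHat (fun t => f t - g t) x = fourierHat f x - fourierHat g x := by
  unfold fourierHat
  simp_rw [mul_sub]
  exact integral_sub (integrable_exp_mul hf x) (integrable_exp_mul hg x)

theorem norm_exp_neg_I_mul (t x : ℝ) : ‖Complex.exp (-(Complex.I * t * x))‖ = 1 := by
  rw [show -(Complex.I * t * x) = ((-(t * x) : ℝ) : ℂ) * Complex.I by push_cast; ring,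
    Complex.norm_exp_ofReal_mul_I]

theorem norm_exp_sub_exp_le (t t' x : ℝ) :
    ‖Complex.exp (-(Complex.I * t * x)) - Complex.exp (-(Complex.I * t' * x))‖ ≤
      |t - t'| * |x| := by
  have : Complex.exp (-(Complex.I * t * x)) - Complex.exp (-(Complex.I * t' * x)) =
      Complex.exp (-(Complex.I * t' * x)) *
        (Complex.exp (Complex.I * ((t' - t) * x : ℝ)) - 1) := by
    rw [mul_sub, ← Complex.exp_add]; push_cast; ring_nf
  rw [this, norm_mul, norm_exp_neg_I_mul, one_mul]
  refine Real.norm_exp_I_mul_ofReal_sub_one_le.trans (le_of_eq ?_)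
  rw [Real.norm_eq_abs, abs_mul, abs_sub_comm]

theorem HatBounds.atom_decay {ψ : ℝ → ℂ} {C : ℝ} (hC : HatBounds ψ C)
    {m s : ℝ} (hm : 0 < m) (hm1 : m ≤ 1) (hs : m ≤ s) (x : ℝ) :
    ‖fourierHat ψ (s * x)‖ ≤ C / (m * (1 + |x|)) := by
  have := hC.pos
  have hs0 := hm.trans_le hs
  refine (hC.decay _).trans ?_
  gcongr
  rw [abs_mul, abs_of_pos hs0]
  nlinarith [abs_nonneg x]

/-- The logarithmic Lipschitz bound at `s' x` and `s x` gives `C (s - s') x / (s' x)`: the frequency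
cancels, which makes the estimate uniform in `x`. -/
theorem HatBounds.dilate_sub_le {ψ : ℝ → ℂ} {C : ℝ} (hψ : IsAnalyticWavelet ψ)
    (hC : HatBounds ψ C) {m s s' : ℝ} (hm : 0 < m) (hs : m ≤ s) (hs' : m ≤ s') (x : ℝ) :
    ‖fourierHat ψ (s * x) - fourierHat ψ (s' * x)‖ ≤ C * |s - s'| / m := by
  wlog h : s' ≤ s generalizing s s'
  · rw [norm_sub_rev, abs_sub_comm]
    exact this hs' hs (le_of_not_ge h)
  have := hC.pos
  rw [abs_of_nonneg (by linarith)]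
  have hss : 0 ≤ s - s' := by linarith
  rcases le_or_gt x 0 with hx | hx
  · rw [hψ.analytic _ (by nlinarith), hψ.analytic _ (by nlinarith)]
    simp; positivity
  · have hp : 0 < s' * x := by have := hm.trans_le hs'; positivity
    refine (hC.logLipschitz (s' * x) (s * x) hp (by gcongr)).trans ?_
    have hs0 := hm.trans_le hs'
    calc _ = C * (s - s') / s' := by field_simp
      _ ≤ _ := by gcongr

/-- A translation costs a factor `|x|`, absorbed by the decay `C / (1 + s|x|)`; a dilation is
uniform in `x` already. -/
theorem HatBounds.atom_sub_le {ψ : ℝ → ℂ} {C : ℝ} (hψ : IsAnalyticWavelet ψ)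
    (hC : HatBounds ψ C) {m s s' t t' : ℝ} (hm : 0 < m) (hs : m ≤ s) (hs' : m ≤ s') (x : ℝ) :
    ‖fourierHat (fun τ => waveletAtom ψ t s τ - waveletAtom ψ t' s' τ) x‖ ≤
      C * (|t - t'| + |s - s'|) / m := by
  have := hC.pos
  have hs0 := hm.trans_le hs
  have hs0' := hm.trans_le hs'
  rw [fourierHat_sub (integrable_waveletAtom hψ.integrable _ hs0)
    (integrable_waveletAtom hψ.integrable _ hs0'), fourierHat_waveletAtom _ _ hs0,
    fourierHat_waveletAtom _ _ hs0']
  have e : Complex.exp (-(Complex.I * t * x)) * fourierHat ψ (s * x) -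
      Complex.exp (-(Complex.I * t' * x)) * fourierHat ψ (s' * x) =
      (Complex.exp (-(Complex.I * t * x)) - Complex.exp (-(Complex.I * t' * x))) *
        fourierHat ψ (s * x) +
      Complex.exp (-(Complex.I * t' * x)) * (fourierHat ψ (s * x) - fourierHat ψ (s' * x)) := by
    ring
  rw [e]
  refine (norm_add_le _ _).trans ?_
  rw [norm_mul, norm_mul, norm_exp_neg_I_mul, one_mul]
  have h1 := hC.dilate_sub_le hψ hm hs hs' x
  have h2 : ‖Complex.exp (-(Complex.I * t * x)) - Complex.exp (-(Complex.I * t' * x))‖ *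
      ‖fourierHat ψ (s * x)‖ ≤ C * |t - t'| / m := by
    calc _ ≤ (|t - t'| * |x|) * (C / (1 + |s * x|)) := by
          gcongr
          · exact norm_exp_sub_exp_le t t' x
          · exact hC.decay _
      _ = C * |t - t'| * (|x| / (1 + |s * x|)) := by ring
      _ ≤ C * |t - t'| * (1 / m) := by
          have : |x| / (1 + |s * x|) ≤ 1 / m := by
            rw [div_le_div_iff₀ (by positivity) hm, abs_mul, abs_of_pos hs0]
            nlinarith [abs_nonneg x]
          exact mul_le_mul_of_nonneg_left this (by positivity)
      _ = _ := by ring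
  calc _ ≤ _ := add_le_add h2 h1
    _ = _ := by ring

theorem HatBounds.atom_sub_le' {ψ : ℝ → ℂ} {C : ℝ} (hψ : IsAnalyticWavelet ψ)
    (hC : HatBounds ψ C) {m s s' t t' : ℝ} (hm : 0 < m) (hm1 : m ≤ 1) (hs : m ≤ s) (hs' : m ≤ s')
    (x : ℝ) :
    ‖fourierHat (fun τ => waveletAtom ψ t s τ - waveletAtom ψ t' s' τ) x‖ ≤
      2 * C / m * (1 + |x|)⁻¹ := by
  have hs0 := hm.trans_le hs
  have hs0' := hm.trans_le hs'
  rw [fourierHat_sub (integrable_waveletAtom hψ.integrable _ hs0)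
    (integrable_waveletAtom hψ.integrable _ hs0'), fourierHat_waveletAtom _ _ hs0,
    fourierHat_waveletAtom _ _ hs0']
  refine (norm_sub_le _ _).trans ?_
  rw [norm_mul, norm_mul, norm_exp_neg_I_mul, norm_exp_neg_I_mul, one_mul, one_mul]
  refine (add_le_add (hC.atom_decay hm hm1 hs x) (hC.atom_decay hm hm1 hs' x)).trans (le_of_eq ?_)
  field_simp
  ring

/-- Interpolates `atom_sub_le`, small but not integrable in frequency, with `atom_sub_le'`, decaying
but not small. Exponent `3/2 > 1` on the second keeps integrability, and `1/2` on the first leaves a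
power of the distance. -/
theorem sq_le_rpow_mul_rpow {y a b : ℝ} (hy : 0 ≤ y) (ha : y ≤ a) (hb : y ≤ b) :
    y ^ 2 ≤ a ^ (1 / 2 : ℝ) * b ^ (3 / 2 : ℝ) := by
  calc y ^ 2 = y ^ (1 / 2 : ℝ) * y ^ (3 / 2 : ℝ) := by
        rw [← Real.rpow_add' hy (by norm_num), ← Real.rpow_natCast]; norm_num
    _ ≤ _ := by
        have := hy.trans ha
        gcongr

/-- Hölder continuity in `L²` of the family of wavelet atoms. -/
theorem exists_lintegral_atom_sub_le {ψ : ℝ → ℂ} {C : ℝ} (hψ : IsAnalyticWavelet ψ)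
    (hC : HatBounds ψ C) : ∃ K : ℝ≥0∞, K ≠ ∞ ∧ ∀ m s s' t t' : ℝ, 0 < m → m ≤ 1 → m ≤ s → m ≤ s' →
      ∫⁻ τ, ‖waveletAtom ψ t s τ - waveletAtom ψ t' s' τ‖ₑ ^ 2 ≤
        K * ENNReal.ofReal ((|t - t'| + |s - s'|) ^ (1 / 2 : ℝ) * (m⁻¹) ^ 2) := by
  have hCp := hC.pos
  refine ⟨ENNReal.ofReal (C ^ (1 / 2 : ℝ) * (2 * C) ^ (3 / 2 : ℝ)) *
    ∫⁻ x : ℝ, ENNReal.ofReal ((1 + |x|) ^ (-(3 / 2) : ℝ)),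
    ENNReal.mul_ne_top ENNReal.ofReal_ne_top
      (lintegral_one_add_abs_rpow_lt_top (by norm_num)).ne, fun m s s' t t' hm hm1 hs hs' => ?_⟩
  have hs0 := hm.trans_le hs
  have hs0' := hm.trans_le hs'
  have hi := (integrable_waveletAtom hψ.integrable t hs0).sub
    (integrable_waveletAtom hψ.integrable t' hs0')
  have hL := (memLp_waveletAtom hψ t hs0).sub (memLp_waveletAtom hψ t' hs0')
  refine (lintegral_sq_le_fourierHat hi hL).trans ?_
  set d := |t - t'| + |s - s'| with hd
  have hd0 : 0 ≤ d := by positivity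
  rw [mul_right_comm, ← ENNReal.ofReal_mul (by positivity),
    ← lintegral_const_mul' _ _ ENNReal.ofReal_ne_top]
  refine lintegral_mono fun x => ?_
  rw [← ofReal_norm, ← ENNReal.ofReal_pow (norm_nonneg _), ← ENNReal.ofReal_mul (by positivity)]
  refine ENNReal.ofReal_le_ofReal ?_
  refine (sq_le_rpow_mul_rpow (norm_nonneg _) (hC.atom_sub_le hψ hm hs hs' x)
    (hC.atom_sub_le' hψ hm hm1 hs hs' x)).trans (le_of_eq ?_)
  have e1 : (m⁻¹) ^ 2 = (m⁻¹) ^ (1 / 2 : ℝ) * (m⁻¹) ^ (3 / 2 : ℝ) := by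
    rw [← Real.rpow_add (by positivity), ← Real.rpow_natCast]; norm_num
  have e2 : (C * d / m) ^ (1 / 2 : ℝ) = C ^ (1 / 2 : ℝ) * d ^ (1 / 2 : ℝ) * m⁻¹ ^ (1 / 2 : ℝ) := by
    rw [div_eq_mul_inv, Real.mul_rpow (by positivity) (by positivity),
      Real.mul_rpow (by positivity) (by positivity)]
  have e3 : (2 * C / m * (1 + |x|)⁻¹) ^ (3 / 2 : ℝ) =
      (2 * C) ^ (3 / 2 : ℝ) * m⁻¹ ^ (3 / 2 : ℝ) * (1 + |x|) ^ (-(3 / 2) : ℝ) := by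
    rw [Real.rpow_neg (by positivity), ← Real.inv_rpow (by positivity), div_eq_mul_inv,
      Real.mul_rpow (by positivity) (by positivity), Real.mul_rpow (by positivity) (by positivity)]
  rw [← hd, e1, e2, e3]
  ring

/-! ### Weighted `L²` estimates for the atoms. -/

/-- The weight `1 + |τ|`. -/
noncomputable def weight (τ : ℝ) : ℝ≥0∞ := ENNReal.ofReal (1 + |τ|)

theorem measurable_weight : Measurable weight := by unfold weight; fun_prop

theorem weight_ne_top (τ : ℝ) : weight τ ≠ ∞ := ENNReal.ofReal_ne_top

theorem one_le_weight (τ : ℝ) : 1 ≤ weight τ := by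
  rw [weight, ENNReal.one_le_ofReal]; linarith [abs_nonneg τ]

theorem lintegral_weight_sq_lt_top {ψ : ℝ → ℂ} {C : ℝ} (hψ : IsAnalyticWavelet ψ)
    (hC : HatBounds ψ C) : ∫⁻ u, weight u ^ 2 * ‖ψ u‖ₑ ^ 2 < ∞ := by
  have h1 := lintegral_mul_sq_lt_top hψ hC
  have h2 := hψ.memLp_two.2
  rw [eLpNorm_lt_top_iff_lintegral_rpow_enorm_lt_top (by norm_num) (by norm_num)] at h2
  simp only [ENNReal.toReal_ofNat, ENNReal.rpow_ofNat] at h2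
  calc ∫⁻ u, weight u ^ 2 * ‖ψ u‖ₑ ^ 2 ≤ ∫⁻ u, (2 * ‖ψ u‖ₑ ^ 2 + 2 * ‖(u : ℂ) * ψ u‖ₑ ^ 2) := by
        refine lintegral_mono fun u => ?_
        rw [enorm_mul, mul_pow, weight, ← ofReal_norm (u : ℂ), Complex.norm_real, Real.norm_eq_abs,
          ← ENNReal.ofReal_pow (by positivity), ← ENNReal.ofReal_pow (by positivity),
          ← mul_assoc, ← add_mul]
        gcongr
        rw [show (2 : ℝ≥0∞) = ENNReal.ofReal 2 by simp, ← ENNReal.ofReal_mul (by positivity),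
          ← ENNReal.ofReal_add (by positivity) (by positivity)]
        refine ENNReal.ofReal_le_ofReal ?_
        nlinarith [sq_nonneg (1 - |u|)]
    _ < ∞ := by
        rw [lintegral_add_left' (by
            have := hψ.memLp_two.1.enorm
            fun_prop), lintegral_const_mul' _ _ (by simp), lintegral_const_mul' _ _ (by simp)]
        exact ENNReal.add_lt_top.2 ⟨ENNReal.mul_lt_top (by simp) h2, ENNReal.mul_lt_top (by simp) h1⟩

/-- After `τ = t + s u`, the weight factors through `1 + |t + s u| ≤ (1 + |t| + s)(1 + |u|)`. -/
theorem lintegral_weight_sq_atom_le (ψ : ℝ → ℂ) (t : ℝ) {s : ℝ} (hs : 0 < s) :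
    ∫⁻ τ, weight τ ^ 2 * ‖waveletAtom ψ t s τ‖ₑ ^ 2 ≤
      ENNReal.ofReal (s⁻¹ * (1 + |t| + s) ^ 2) * ∫⁻ u, weight u ^ 2 * ‖ψ u‖ₑ ^ 2 := by
  rw [lintegral_enorm_waveletAtom ψ t hs (fun τ => weight τ ^ 2),
    ENNReal.ofReal_mul (by positivity), mul_assoc]
  gcongr
  rw [← lintegral_const_mul' _ _ ENNReal.ofReal_ne_top]
  refine lintegral_mono fun u => ?_
  rw [← mul_assoc]
  gcongr
  rw [ENNReal.ofReal_pow (by positivity), ← mul_pow, weight, weight,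
    ← ENNReal.ofReal_mul (by positivity)]
  gcongr
  have : |t + s * u| ≤ |t| + s * |u| := by
    refine (abs_add_le _ _).trans ?_
    rw [abs_mul, abs_of_pos hs]
  nlinarith [abs_nonneg t, abs_nonneg u]

/-- Hölder with exponents `1/4` and `3/4`. The weight power `3/2` exceeds `1`, so that its
reciprocal is integrable, and is below `2`, so that a positive power of the unweighted norm
survives. -/
theorem lintegral_weight_rpow_le {g : ℝ → ℂ} (hg : AEStronglyMeasurable g volume) :
    ∫⁻ τ, weight τ ^ (3 / 2 : ℝ) * ‖g τ‖ₑ ^ 2 ≤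
      (∫⁻ τ, ‖g τ‖ₑ ^ 2) ^ (1 / 4 : ℝ) * (∫⁻ τ, weight τ ^ 2 * ‖g τ‖ₑ ^ 2) ^ (3 / 4 : ℝ) := by
  have hm := measurable_weight
  have hge := hg.enorm
  refine le_trans (lintegral_mono fun τ => ?_) (ENNReal.lintegral_mul_norm_pow_le
    (f := fun τ => ‖g τ‖ₑ ^ 2) (g := fun τ => weight τ ^ 2 * ‖g τ‖ₑ ^ 2)
    (by fun_prop) (by fun_prop) (p := 1 / 4) (q := 3 / 4) (by norm_num) (by norm_num) (by norm_num))
  rw [ENNReal.mul_rpow_of_nonneg _ _ (by norm_num), mul_left_comm, ← ENNReal.rpow_add_of_nonneg _ _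
    (by norm_num) (by norm_num), ← ENNReal.rpow_natCast (weight τ), ← ENNReal.rpow_mul]
  norm_num

/-- Hölder continuity, in a weighted `L²` space, of the family of wavelet atoms. -/
theorem exists_lintegral_weight_atom_sub_le {ψ : ℝ → ℂ} {C : ℝ} (hψ : IsAnalyticWavelet ψ)
    (hC : HatBounds ψ C) : ∃ K : ℝ≥0∞, K ≠ ∞ ∧ ∀ N s s' t t' : ℝ, 1 ≤ N → N⁻¹ ≤ s → s ≤ N →
      N⁻¹ ≤ s' → s' ≤ N → |t| ≤ N → |t'| ≤ N →
      ∫⁻ τ, weight τ ^ (3 / 2 : ℝ) * ‖waveletAtom ψ t s τ - waveletAtom ψ t' s' τ‖ₑ ^ 2 ≤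
        K * ENNReal.ofReal ((|t - t'| + |s - s'|) ^ (1 / 8 : ℝ) * N ^ 3) := by
  obtain ⟨K, hK, h⟩ := exists_lintegral_atom_sub_le hψ hC
  set D := ∫⁻ u, weight u ^ 2 * ‖ψ u‖ₑ ^ 2 with hD
  have hDt : D ≠ ∞ := (lintegral_weight_sq_lt_top hψ hC).ne
  refine ⟨K ^ (1 / 4 : ℝ) * (36 * D) ^ (3 / 4 : ℝ), by finiteness,
    fun N s s' t t' hN hs hsN hs' hsN' ht ht' => ?_⟩
  have hN0 : 0 < N := by linarith
  have hm : 0 < N⁻¹ := by positivity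
  have hs0 := hm.trans_le hs
  have hs0' := hm.trans_le hs'
  have a1 := h N⁻¹ s s' t t' hm (inv_le_one_of_one_le₀ hN) hs hs'
  set d := |t - t'| + |s - s'| with hd
  have hd0 : 0 ≤ d := by positivity
  have hatom (t s : ℝ) (hs0 : 0 < s) (hs : N⁻¹ ≤ s) (hsN : s ≤ N) (ht : |t| ≤ N) :
      ∫⁻ τ, weight τ ^ 2 * ‖waveletAtom ψ t s τ‖ₑ ^ 2 ≤ ENNReal.ofReal (9 * N ^ 3) * D := by
    refine (lintegral_weight_sq_atom_le ψ t hs0).trans ?_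
    gcongr ENNReal.ofReal ?_ * _
    have : s⁻¹ ≤ N := inv_le_of_inv_le₀ hN0 hs
    calc s⁻¹ * (1 + |t| + s) ^ 2 ≤ N * (N + N + N) ^ 2 := by gcongr
      _ = _ := by ring
  have i1 := integrable_waveletAtom hψ.integrable t hs0
  have i2 := integrable_waveletAtom hψ.integrable t' hs0'
  -- No smallness is sought here: each atom contributes at most `9 N³ D`, and `36 = 2·9 + 2·9`.
  have a2 : ∫⁻ τ, weight τ ^ 2 * ‖waveletAtom ψ t s τ - waveletAtom ψ t' s' τ‖ₑ ^ 2 ≤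
      (36 * D) * ENNReal.ofReal (N ^ 3) := by
    calc _ ≤ ∫⁻ τ, (2 * (weight τ ^ 2 * ‖waveletAtom ψ t s τ‖ₑ ^ 2) +
          2 * (weight τ ^ 2 * ‖waveletAtom ψ t' s' τ‖ₑ ^ 2)) := by
          refine lintegral_mono fun τ => ?_
          have : ‖waveletAtom ψ t s τ - waveletAtom ψ t' s' τ‖ₑ ^ 2 ≤
              2 * ‖waveletAtom ψ t s τ‖ₑ ^ 2 + 2 * ‖waveletAtom ψ t' s' τ‖ₑ ^ 2 := by
            simp_rw [← ofReal_norm]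
            rw [← ENNReal.ofReal_pow (by positivity), ← ENNReal.ofReal_pow (by positivity),
              ← ENNReal.ofReal_pow (by positivity), show (2 : ℝ≥0∞) = ENNReal.ofReal 2 by simp,
              ← ENNReal.ofReal_mul (by positivity), ← ENNReal.ofReal_mul (by positivity),
              ← ENNReal.ofReal_add (by positivity) (by positivity)]
            refine ENNReal.ofReal_le_ofReal ?_
            have h1 := norm_sub_le (waveletAtom ψ t s τ) (waveletAtom ψ t' s' τ)
            nlinarith [norm_nonneg (waveletAtom ψ t s τ - waveletAtom ψ t' s' τ),
              sq_nonneg (‖waveletAtom ψ t s τ‖ - ‖waveletAtom ψ t' s' τ‖)]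
          calc _ ≤ weight τ ^ 2 * (2 * ‖waveletAtom ψ t s τ‖ₑ ^ 2 +
                2 * ‖waveletAtom ψ t' s' τ‖ₑ ^ 2) := by gcongr
            _ = _ := by ring
      _ ≤ 2 * (ENNReal.ofReal (9 * N ^ 3) * D) + 2 * (ENNReal.ofReal (9 * N ^ 3) * D) := by
          have := measurable_weight
          have := i1.aestronglyMeasurable.enorm
          rw [lintegral_add_left' (by fun_prop), lintegral_const_mul' _ _ (by simp),
            lintegral_const_mul' _ _ (by simp)]
          gcongr
          · exact hatom t s hs0 hs hsN ht
          · exact hatom t' s' hs0' hs' hsN' ht'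
      _ = _ := by
          rw [ENNReal.ofReal_mul (by norm_num)]
          simp only [ENNReal.ofReal_ofNat]
          ring
  refine (lintegral_weight_rpow_le (i1.sub i2).aestronglyMeasurable).trans ?_
  calc _ ≤ (K * ENNReal.ofReal (d ^ (1 / 2 : ℝ) * N⁻¹⁻¹ ^ 2)) ^ (1 / 4 : ℝ) *
        ((36 * D) * ENNReal.ofReal (N ^ 3)) ^ (3 / 4 : ℝ) := by
        simp only [Pi.sub_apply]
        gcongr
    _ = K ^ (1 / 4 : ℝ) * (36 * D) ^ (3 / 4 : ℝ) *
        ENNReal.ofReal ((d ^ (1 / 2 : ℝ) * N⁻¹⁻¹ ^ 2) ^ (1 / 4 : ℝ) * (N ^ 3) ^ (3 / 4 : ℝ)) := by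
        rw [ENNReal.mul_rpow_of_nonneg _ _ (by norm_num),
          ENNReal.mul_rpow_of_nonneg _ _ (by norm_num),
          ENNReal.ofReal_rpow_of_nonneg (by positivity) (by norm_num),
          ENNReal.ofReal_rpow_of_nonneg (by positivity) (by norm_num),
          ENNReal.ofReal_mul (by positivity)]
        ring
    _ ≤ _ := by
        gcongr K ^ (1 / 4 : ℝ) * (36 * D) ^ (3 / 4 : ℝ) * ENNReal.ofReal ?_
        -- The exponents combine to `d^(1/8)` and `N^(2/4 + 9/4) = N^(11/4)`, rounded up to `N³`.
        rw [inv_inv, Real.mul_rpow (by positivity) (by positivity), ← Real.rpow_mul hd0,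
          ← Real.rpow_natCast, ← Real.rpow_natCast, ← Real.rpow_mul hN0.le, ← Real.rpow_mul hN0.le,
          mul_assoc, ← Real.rpow_add hN0]
        exact mul_le_mul (le_of_eq (by norm_num))
          (Real.rpow_le_rpow_of_exponent_le hN (by norm_num)) (by positivity) (by positivity)

end WaveletNoise

/-! ### The centered noise and weighted integrability of its paths. -/

namespace WaveletNoise

variable {Ω : Type*} [MeasurableSpace Ω] {P : Measure Ω}

/-- A jointly measurable centered Gaussian process with constant second moment `V` and covariance
given by the spectral density `p`. -/
structure IsCenteredNoise (P : Measure Ω) (Z : ℝ → Ω → ℝ) (p : ℝ → ℝ) (V : ℝ≥0∞) : Prop where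
  measurable : Measurable (Function.uncurry Z)
  gaussian : ∀ (I : Finset ℝ) (c : ℝ → ℝ), ∃ v : ℝ≥0,
    HasLaw (fun ω => ∑ t ∈ I, c t * Z t ω) (gaussianReal 0 v) P
  ne_top : V ≠ ∞
  second_moment : ∀ t, ∫⁻ ω, ‖Z t ω‖ₑ ^ 2 ∂P = V
  nonneg : ∀ x, 0 ≤ p x
  integrable : Integrable p
  cov_eq : ∀ a b, ((∫ ω, Z a ω * Z b ω ∂P : ℝ) : ℂ) =
    ∫ x : ℝ, Complex.exp (Complex.I * (a - b : ℝ) * x) * (p x : ℂ)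

theorem IsGaussianNoise.identDistrib {Φ : ℝ → Ω → ℝ} {p : ℝ → ℝ} (h : IsGaussianNoise P Φ p)
    (t : ℝ) : IdentDistrib (Φ t) (Φ 0) P P := by
  have h1 := (h.stationary t {0}).comp
    (u := fun x : ({0} : Finset ℝ) → ℝ => x ⟨0, by simp⟩) (by fun_prop)
  simpa [Function.comp_def] using h1

theorem IsGaussianNoise.identDistrib_pair {Φ : ℝ → Ω → ℝ} {p : ℝ → ℝ} (h : IsGaussianNoise P Φ p)
    (a b : ℝ) : IdentDistrib (fun ω => (Φ a ω, Φ b ω)) (fun ω => (Φ (a - b) ω, Φ 0 ω)) P P := by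
  have h1 := (h.stationary b {a - b, 0}).comp
    (u := fun x : ({a - b, 0} : Finset ℝ) → ℝ => (x ⟨a - b, by simp⟩, x ⟨0, by simp⟩))
    (by fun_prop)
  simpa [Function.comp_def] using h1

theorem IsGaussianNoise.memLp {Φ : ℝ → Ω → ℝ} {p : ℝ → ℝ} (h : IsGaussianNoise P Φ p)
    (t : ℝ) : MemLp (Φ t) 2 P :=
  (h.gaussian.hasGaussianLaw_eval t).memLp_two

theorem lintegral_sq_eq_eLpNorm {α E : Type*} [MeasurableSpace α] [NormedAddCommGroup E]
    (μ : Measure α) (f : α → E) : ∫⁻ x, ‖f x‖ₑ ^ 2 ∂μ = eLpNorm f 2 μ ^ 2 := by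
  rw [eLpNorm_eq_lintegral_rpow_enorm_toReal (by norm_num) (by norm_num),
    ← ENNReal.rpow_natCast, ← ENNReal.rpow_mul]
  simp

/-- Stationarity makes the mean constant, so one constant centers every finite linear combination,
and shifting a pair by `b` makes its covariance a function of `a - b`. -/
theorem IsGaussianNoise.isCenteredNoise [IsProbabilityMeasure P] {Φ : ℝ → Ω → ℝ} {p : ℝ → ℝ} (h : IsGaussianNoise P Φ p) :
    ∃ V, IsCenteredNoise P (fun t ω => Φ t ω - ∫ ω', Φ 0 ω' ∂P) p V := by
  set m := ∫ ω', Φ 0 ω' ∂P with hm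
  have hmean (t : ℝ) : ∫ ω, Φ t ω ∂P = m := (h.identDistrib t).integral_eq
  refine ⟨∫⁻ ω, ‖Φ 0 ω - m‖ₑ ^ 2 ∂P, h.measurable.sub_const m, fun I c => ?_, ?_, fun t => ?_,
    fun x => (h.spectralDensity.pos x).le, h.spectralDensity.integrable, fun a b => ?_⟩
  · let L : (I → ℝ) →L[ℝ] ℝ := ∑ i : I, c i • ContinuousLinearMap.proj i
    have hL : HasGaussianLaw (fun ω => ∑ t ∈ I, c t * Φ t ω) P := by
      have := (h.gaussian.hasGaussianLaw I).map_fun L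
      refine this.congr (ae_of_all _ fun ω => ?_)
      simp [L, ← Finset.sum_coe_sort I]
    have hlaw : HasLaw (fun ω => ∑ t ∈ I, c t * Φ t ω)
        (gaussianReal (∑ t ∈ I, c t * m)
          Var[id; P.map (fun ω => ∑ t ∈ I, c t * Φ t ω)].toNNReal) P := by
      refine ⟨hL.aemeasurable, ?_⟩
      refine (IsGaussian.eq_gaussianReal _ hL.isGaussian_map).trans ?_
      congr 1
      rw [integral_map hL.aemeasurable (by fun_prop)]
      simp only [id]
      rw [integral_finsetSum _ fun t _ => ((h.memLp t).integrable (by norm_num)).const_mul _]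
      simp_rw [integral_const_mul, hmean]
    have h2 := gaussianReal_sub_const hlaw (∑ t ∈ I, c t * m)
    rw [sub_self] at h2
    refine ⟨_, h2.congr (ae_of_all _ fun ω => ?_)⟩
    simp only [mul_sub, Finset.sum_sub_distrib]
  · rw [lintegral_sq_eq_eLpNorm]
    exact (ENNReal.pow_lt_top ((h.memLp 0).sub (memLp_const m)).2).ne
  · have := ((h.identDistrib t).comp (u := fun x => ‖x - m‖ₑ ^ 2) (by fun_prop)).lintegral_eq
    simpa using this
  · have h1 := ((h.identDistrib_pair a b).comp
      (u := fun x : ℝ × ℝ => (x.1 - m) * (x.2 - m)) (by fun_prop)).integral_eq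
    simp only [Function.comp_def] at h1
    rw [← h.spectralDensity.cov_eq (a - b), h1, covariance, hmean, hmean]

/-- Second moment of the weighted path. -/
theorem ae_lintegral_weight_lt_top [SFinite P] {X : ℝ → Ω → ℝ} (hX : Measurable (Function.uncurry X))
    {V : ℝ≥0∞} (hV : V ≠ ∞) (h2 : ∀ t, ∫⁻ ω, ‖X t ω‖ₑ ^ 2 ∂P = V) :
    ∀ᵐ ω ∂P, ∫⁻ τ, weight τ ^ (-(3 / 2) : ℝ) * ‖X τ ω‖ₑ ^ 2 < ∞ := by
  have hw := measurable_weight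
  have hm : Measurable fun z : Ω × ℝ => weight z.2 ^ (-(3 / 2) : ℝ) * ‖X z.2 z.1‖ₑ ^ 2 := by
    have : Measurable fun z : Ω × ℝ => X z.2 z.1 := hX.comp measurable_swap
    fun_prop
  refine ae_lt_top hm.lintegral_prod_right' ?_
  rw [lintegral_lintegral_swap hm.aemeasurable]
  have e : ∀ τ, ∫⁻ ω, weight τ ^ (-(3 / 2) : ℝ) * ‖X τ ω‖ₑ ^ 2 ∂P =
      weight τ ^ (-(3 / 2) : ℝ) * V := by
    intro τ
    rw [lintegral_const_mul' , h2]
    exact ENNReal.rpow_ne_top_of_ne_zero (zero_lt_one.trans_le (one_le_weight τ)).ne'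
      (weight_ne_top τ)
  simp_rw [e]
  rw [lintegral_mul_const' _ _ hV]
  refine ENNReal.mul_ne_top ?_ hV
  have := lintegral_one_add_abs_rpow_lt_top (r := 3 / 2) (by norm_num)
  refine (lt_of_le_of_lt (le_of_eq ?_) this).ne
  congr 1 with τ
  rw [weight, ENNReal.ofReal_rpow_of_pos (by positivity)]

/-- Weighted Cauchy–Schwarz inequality. -/
theorem lintegral_mul_sq_le_weight {f : ℝ → ℝ} {g : ℝ → ℂ} (hf : AEStronglyMeasurable f volume)
    (hg : AEStronglyMeasurable g volume) :
    (∫⁻ τ, ‖(f τ : ℂ) * g τ‖ₑ) ^ 2 ≤ (∫⁻ τ, weight τ ^ (-(3 / 2) : ℝ) * ‖f τ‖ₑ ^ 2) *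
      ∫⁻ τ, weight τ ^ (3 / 2 : ℝ) * ‖g τ‖ₑ ^ 2 := by
  have hw := measurable_weight
  have hfe := hf.enorm
  have hge := hg.enorm
  have h := ENNReal.lintegral_mul_norm_pow_le (μ := volume)
    (f := fun τ => weight τ ^ (-(3 / 2) : ℝ) * ‖f τ‖ₑ ^ 2)
    (g := fun τ => weight τ ^ (3 / 2 : ℝ) * ‖g τ‖ₑ ^ 2)
    (by fun_prop) (by fun_prop) (p := 1 / 2) (q := 1 / 2) (by norm_num) (by norm_num) (by norm_num)
  have e : ∀ τ, ‖(f τ : ℂ) * g τ‖ₑ = (weight τ ^ (-(3 / 2) : ℝ) * ‖f τ‖ₑ ^ 2) ^ (1 / 2 : ℝ) *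
      (weight τ ^ (3 / 2 : ℝ) * ‖g τ‖ₑ ^ 2) ^ (1 / 2 : ℝ) := by
    intro τ
    have hw0 : weight τ ≠ 0 := (zero_lt_one.trans_le (one_le_weight τ)).ne'
    rw [← ENNReal.mul_rpow_of_nonneg _ _ (by norm_num), mul_mul_mul_comm,
      ← ENNReal.rpow_add _ _ hw0 (weight_ne_top τ), ← mul_pow, enorm_mul, ← ENNReal.rpow_natCast,
      neg_add_cancel, ENNReal.rpow_zero, one_mul, ← ENNReal.rpow_mul]
    norm_num
    congr 1
    rw [← ofReal_norm, Complex.norm_real, ofReal_norm]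
  simp_rw [e]
  calc _ ≤ _ := pow_le_pow_left' h 2
    _ = _ := by
      rw [mul_pow, ← ENNReal.rpow_natCast, ← ENNReal.rpow_natCast, ← ENNReal.rpow_mul,
        ← ENNReal.rpow_mul]
      norm_num

end WaveletNoise

/-! ### Spectral representation of the second moment. -/

namespace WaveletNoise

variable {Ω : Type*} [MeasurableSpace Ω] {P : Measure Ω}

namespace IsCenteredNoise

variable {Z : ℝ → Ω → ℝ} {p : ℝ → ℝ} {V : ℝ≥0∞}

theorem measurable_eval (h : IsCenteredNoise P Z p V) (t : ℝ) : Measurable (Z t) :=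
  h.measurable.comp (measurable_const.prodMk measurable_id)

theorem memLp (h : IsCenteredNoise P Z p V) (t : ℝ) : MemLp (Z t) 2 P := by
  refine ⟨(h.measurable_eval t).aestronglyMeasurable, ?_⟩
  have := h.second_moment t
  rw [lintegral_sq_eq_eLpNorm] at this
  by_contra hcon
  rw [not_lt, top_le_iff] at hcon
  rw [hcon] at this
  exact h.ne_top (by rw [← this]; simp)

theorem enorm_mul_le_sq_add_sq (a b : ℝ≥0∞) : a * b ≤ a ^ 2 + b ^ 2 := by
  rcases le_total a b with h | h
  · calc a * b ≤ b * b := by gcongr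
      _ = b ^ 2 := (sq b).symm
      _ ≤ _ := le_add_self
  · calc a * b ≤ a * a := by gcongr
      _ = a ^ 2 := (sq a).symm
      _ ≤ _ := le_self_add

theorem lintegral_mul_le (h : IsCenteredNoise P Z p V) {y : Ω → ℝ} (hy : MemLp y 2 P) (t : ℝ) :
    ∫⁻ ω, ‖y ω‖ₑ * ‖Z t ω‖ₑ ∂P ≤ eLpNorm y 2 P ^ 2 + V := by
  have := hy.1.enorm
  calc _ ≤ ∫⁻ ω, (‖y ω‖ₑ ^ 2 + ‖Z t ω‖ₑ ^ 2) ∂P :=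
        lintegral_mono fun ω => enorm_mul_le_sq_add_sq _ _
    _ = _ := by rw [lintegral_add_left' (by fun_prop), h.second_moment, lintegral_sq_eq_eLpNorm]

theorem measurable_swap (h : IsCenteredNoise P Z p V) : Measurable fun z : Ω × ℝ => Z z.2 z.1 :=
  h.measurable.comp _root_.measurable_swap

/-- Fubini's hypothesis for pairing the integral with an arbitrary `y ∈ L²`, as the orthogonality
argument for the closed span requires. -/
theorem integrable_mul_mul [SFinite P] (h : IsCenteredNoise P Z p V) {y : Ω → ℝ} (hy : MemLp y 2 P)
    {g : ℝ → ℝ} (hg : Integrable g) :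
    Integrable (fun z : Ω × ℝ => y z.1 * (Z z.2 z.1 * g z.2)) (P.prod volume) := by
  have hm := h.measurable_swap
  have h1 : AEStronglyMeasurable (fun z : Ω × ℝ => y z.1) (P.prod volume) := hy.1.comp_fst
  have h2 : AEStronglyMeasurable (fun z : Ω × ℝ => g z.2) (P.prod volume) :=
    hg.aestronglyMeasurable.comp_snd
  have h0 : AEStronglyMeasurable (fun z : Ω × ℝ => y z.1 * (Z z.2 z.1 * g z.2))
    (P.prod volume) := h1.mul (hm.aestronglyMeasurable.mul h2)
  refine ⟨h0, ?_⟩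
  rw [hasFiniteIntegral_iff_enorm, lintegral_prod_symm _ h0.enorm]
  calc _ ≤ ∫⁻ τ, (eLpNorm y 2 P ^ 2 + V) * ‖g τ‖ₑ := by
        refine lintegral_mono fun τ => ?_
        simp_rw [enorm_mul, ← mul_assoc]
        rw [lintegral_mul_const' _ _ enorm_ne_top]
        gcongr
        exact h.lintegral_mul_le hy τ
    _ < ∞ := by
        have hfin := hy.2.ne
        have := h.ne_top
        rw [lintegral_const_mul' _ _ (by finiteness)]
        exact ENNReal.mul_lt_top (by finiteness) hg.2

theorem integrable_mul [IsFiniteMeasure P] (h : IsCenteredNoise P Z p V)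
    {g : ℝ → ℝ} (hg : Integrable g) :
    Integrable (fun z : Ω × ℝ => Z z.2 z.1 * g z.2) (P.prod volume) := by
  simpa using h.integrable_mul_mul (memLp_const (1 : ℝ)) hg

theorem integrable_mul_complex [IsFiniteMeasure P] (h : IsCenteredNoise P Z p V)
    {g : ℝ → ℂ} (hg : Integrable g) :
    Integrable (fun z : Ω × ℝ => (Z z.2 z.1 : ℂ) * g z.2) (P.prod volume) := by
  have hm := h.measurable_swap
  have h2 : AEStronglyMeasurable (fun z : Ω × ℝ => g z.2) (P.prod volume) :=
    hg.aestronglyMeasurable.comp_snd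
  refine (h.integrable_mul hg.norm).mono ?_ (ae_of_all _ fun z => ?_)
  · exact (Complex.measurable_ofReal.comp hm).aestronglyMeasurable.mul h2
  · simp

theorem integrable_quadratic [SFinite P] (h : IsCenteredNoise P Z p V)
    {g : ℝ → ℂ} (hg : Integrable g) :
    Integrable (fun z : Ω × (ℝ × ℝ) => ((Z z.2.1 z.1 : ℂ) * g z.2.1) *
      (starRingEnd ℂ) ((Z z.2.2 z.1 : ℂ) * g z.2.2)) (P.prod (volume.prod volume)) := by
  have hm1 : Measurable fun z : Ω × (ℝ × ℝ) => Z z.2.1 z.1 :=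
    h.measurable.comp (by fun_prop : Measurable fun z : Ω × (ℝ × ℝ) => (z.2.1, z.1))
  have hm2 : Measurable fun z : Ω × (ℝ × ℝ) => Z z.2.2 z.1 :=
    h.measurable.comp (by fun_prop : Measurable fun z : Ω × (ℝ × ℝ) => (z.2.2, z.1))
  have g1 : AEStronglyMeasurable (fun z : Ω × (ℝ × ℝ) => g z.2.1) (P.prod (volume.prod volume)) :=
    (hg.aestronglyMeasurable.comp_fst (ν := volume)).comp_snd
  have g2 : AEStronglyMeasurable (fun z : Ω × (ℝ × ℝ) => g z.2.2) (P.prod (volume.prod volume)) :=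
    (hg.aestronglyMeasurable.comp_snd (μ := volume)).comp_snd
  have h0 : AEStronglyMeasurable (fun z : Ω × (ℝ × ℝ) => ((Z z.2.1 z.1 : ℂ) * g z.2.1) *
      (starRingEnd ℂ) ((Z z.2.2 z.1 : ℂ) * g z.2.2)) (P.prod (volume.prod volume)) :=
    ((Complex.measurable_ofReal.comp hm1).aestronglyMeasurable.mul g1).mul
      (Complex.continuous_conj.comp_aestronglyMeasurable
        ((Complex.measurable_ofReal.comp hm2).aestronglyMeasurable.mul g2))
  refine ⟨h0, ?_⟩
  rw [hasFiniteIntegral_iff_enorm, lintegral_prod_symm _ h0.enorm]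
  have hge := hg.aestronglyMeasurable.enorm
  calc _ ≤ ∫⁻ z : ℝ × ℝ, (V + V) * (‖g z.1‖ₑ * ‖g z.2‖ₑ) := by
        refine lintegral_mono fun z => ?_
        have e : ∀ ω, ‖((Z z.1 ω : ℂ) * g z.1) * (starRingEnd ℂ) ((Z z.2 ω : ℂ) * g z.2)‖ₑ =
            (‖Z z.1 ω‖ₑ * ‖Z z.2 ω‖ₑ) * (‖g z.1‖ₑ * ‖g z.2‖ₑ) := by
          intro ω
          have hr (r : ℝ) : ‖(r : ℂ)‖ₑ = ‖r‖ₑ := by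
            rw [← ofReal_norm, Complex.norm_real, ofReal_norm]
          rw [enorm_mul, RCLike.enorm_conj, enorm_mul, enorm_mul, hr, hr]
          ring
        simp_rw [e]
        rw [lintegral_mul_const' _ _ (by finiteness)]
        gcongr
        refine (h.lintegral_mul_le (h.memLp _) _).trans (le_of_eq ?_)
        rw [← lintegral_sq_eq_eLpNorm, h.second_moment]
    _ < ∞ := by
        have := h.ne_top
        rw [lintegral_const_mul' _ _ (by finiteness), Measure.volume_eq_prod,
          lintegral_prod_mul hge hge]
        have := hg.2.ne
        finiteness

/-- The spectral representation of the second moment of `∫ Z τ * g τ dτ`. -/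
theorem lintegral_sq_integral [IsFiniteMeasure P] (h : IsCenteredNoise P Z p V)
    {g : ℝ → ℂ} (hg : Integrable g) :
    ∫⁻ ω, ‖∫ τ, (Z τ ω : ℂ) * g τ‖ₑ ^ 2 ∂P =
      ∫⁻ x, ‖fourierHat g x‖ₑ ^ 2 * ENNReal.ofReal (p x) := by
  have hq := h.integrable_quadratic hg
  have hint := hq.integral_prod_left
  have e1 : ∀ ω, ∫ z : ℝ × ℝ, ((Z z.1 ω : ℂ) * g z.1) * (starRingEnd ℂ) ((Z z.2 ω : ℂ) * g z.2) =
      ((‖∫ τ, (Z τ ω : ℂ) * g τ‖ ^ 2 : ℝ) : ℂ) := by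
    intro ω
    rw [Measure.volume_eq_prod, integral_prod_mul (fun τ => (Z τ ω : ℂ) * g τ)
      (fun τ => (starRingEnd ℂ) ((Z τ ω : ℂ) * g τ)), integral_conj, Complex.mul_conj,
      Complex.normSq_eq_norm_sq]
  have e2 : ∀ z : ℝ × ℝ, ∫ ω, ((Z z.1 ω : ℂ) * g z.1) * (starRingEnd ℂ) ((Z z.2 ω : ℂ) * g z.2) ∂P =
      ∫ x : ℝ, (Complex.exp (-(Complex.I * z.1 * x)) * g z.1) *
        (starRingEnd ℂ) (Complex.exp (-(Complex.I * z.2 * x)) * g z.2) * (p x : ℂ) := by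
    intro z
    -- The two factors are swapped so that the covariance is `∫ exp(i (z.2 - z.1) x) p(x) dx`,
    -- matching the sign convention of `fourierHat`.
    have : ∀ ω, ((Z z.1 ω : ℂ) * g z.1) * (starRingEnd ℂ) ((Z z.2 ω : ℂ) * g z.2) =
        (g z.1 * (starRingEnd ℂ) (g z.2)) * ((Z z.2 ω * Z z.1 ω : ℝ) : ℂ) := by
      intro ω; simp; ring
    simp_rw [this]
    rw [integral_const_mul, integral_complex_ofReal, h.cov_eq, ← integral_const_mul]
    congr 1 with x
    rw [map_mul, ← Complex.exp_conj]
    have : Complex.exp (Complex.I * (z.2 - z.1 : ℝ) * x) = Complex.exp (-(Complex.I * z.1 * x)) *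
        Complex.exp ((starRingEnd ℂ) (-(Complex.I * z.2 * x))) := by
      rw [← Complex.exp_add]; congr 1; simp; ring
    rw [this]
    ring
  have hint2 : Integrable (fun w : (ℝ × ℝ) × ℝ => (Complex.exp (-(Complex.I * w.1.1 * w.2)) * g w.1.1) *
        (starRingEnd ℂ) (Complex.exp (-(Complex.I * w.1.2 * w.2)) * g w.1.2) * (p w.2 : ℂ))
      ((volume.prod volume).prod volume) := by
    have hgc : Integrable (fun τ => (starRingEnd ℂ) (g τ)) :=
      hg.norm.mono (Complex.continuous_conj.comp_aestronglyMeasurable hg.1)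
        (ae_of_all _ fun τ => by simp)
    have hpc : Integrable (fun x => (p x : ℂ)) := h.integrable.ofReal
    have hb := (hg.mul_prod hgc).mul_prod hpc
    have := hb.bdd_mul (c := 1) (f := fun w : (ℝ × ℝ) × ℝ => Complex.exp (-(Complex.I * w.1.1 * w.2)) *
      (starRingEnd ℂ) (Complex.exp (-(Complex.I * w.1.2 * w.2))))
      (by
        refine Continuous.aestronglyMeasurable ?_
        exact (by fun_prop : Continuous fun w : (ℝ × ℝ) × ℝ => Complex.exp (-(Complex.I * w.1.1 * w.2))).mul
          (Complex.continuous_conj.comp (by fun_prop)))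
      (ae_of_all _ fun w => by
        rw [norm_mul, RCLike.norm_conj, norm_exp_neg_I_mul, norm_exp_neg_I_mul, one_mul])
    refine this.congr (ae_of_all _ fun w => ?_)
    simp
    ring
  have e3 : ∀ x : ℝ, ∫ z : ℝ × ℝ, (Complex.exp (-(Complex.I * z.1 * x)) * g z.1) *
        (starRingEnd ℂ) (Complex.exp (-(Complex.I * z.2 * x)) * g z.2) * (p x : ℂ) =
      ((‖fourierHat g x‖ ^ 2 * p x : ℝ) : ℂ) := by
    intro x
    rw [integral_mul_const, Measure.volume_eq_prod,
      integral_prod_mul (fun τ : ℝ => Complex.exp (-(Complex.I * τ * x)) * g τ)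
      (fun τ : ℝ => (starRingEnd ℂ) (Complex.exp (-(Complex.I * τ * x)) * g τ)), integral_conj,
      Complex.mul_conj, Complex.normSq_eq_norm_sq]
    simp [fourierHat]
  -- Both sides are iterated integrals over pairs of times: Fubini is used once to bring the
  -- expectation inside and once to take the frequency outside.
  have main : ((∫ ω, ‖∫ τ, (Z τ ω : ℂ) * g τ‖ ^ 2 ∂P : ℝ) : ℂ) =
      ((∫ x, ‖fourierHat g x‖ ^ 2 * p x : ℝ) : ℂ) := by
    rw [← integral_complex_ofReal, ← integral_complex_ofReal]
    simp_rw [← e1, ← e3]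
    have sw1 := integral_integral_swap (f := fun (ω : Ω) (z : ℝ × ℝ) =>
      ((Z z.1 ω : ℂ) * g z.1) * (starRingEnd ℂ) ((Z z.2 ω : ℂ) * g z.2)) hq
    have sw2 := integral_integral_swap (f := fun (z : ℝ × ℝ) (x : ℝ) =>
      (Complex.exp (-(Complex.I * z.1 * x)) * g z.1) *
        (starRingEnd ℂ) (Complex.exp (-(Complex.I * z.2 * x)) * g z.2) * (p x : ℂ)) hint2
    rw [Measure.volume_eq_prod ℝ ℝ, sw1, ← sw2]
    simp_rw [← e2]
  have main' := Complex.ofReal_injective main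
  have i1 : Integrable (fun ω => ‖∫ τ, (Z τ ω : ℂ) * g τ‖ ^ 2) P := by
    have : Integrable (fun ω => (((‖∫ τ, (Z τ ω : ℂ) * g τ‖ ^ 2 : ℝ)) : ℂ)) P := by
      simp_rw [← e1]; exact hint
    exact_mod_cast this.re
  have i2 : Integrable (fun x => ‖fourierHat g x‖ ^ 2 * p x) := by
    have : Integrable (fun x => ((‖fourierHat g x‖ ^ 2 * p x : ℝ) : ℂ)) := by
      simp_rw [← e3]; exact hint2.integral_prod_right
    exact_mod_cast this.re
  have j1 := ofReal_integral_eq_lintegral_ofReal i1 (ae_of_all _ fun ω => by positivity)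
  have j2 := ofReal_integral_eq_lintegral_ofReal i2
    (ae_of_all _ fun x => mul_nonneg (by positivity) (h.nonneg x))
  rw [main'] at j1
  have k1 : ∀ ω, ‖∫ τ, (Z τ ω : ℂ) * g τ‖ₑ ^ 2 =
      ENNReal.ofReal (‖∫ τ, (Z τ ω : ℂ) * g τ‖ ^ 2) := fun ω => by
    rw [ENNReal.ofReal_pow (norm_nonneg _), ofReal_norm]
  have k2 : ∀ x, ‖fourierHat g x‖ₑ ^ 2 * ENNReal.ofReal (p x) =
      ENNReal.ofReal (‖fourierHat g x‖ ^ 2 * p x) := fun x => by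
    rw [ENNReal.ofReal_mul (by positivity), ENNReal.ofReal_pow (norm_nonneg _), ofReal_norm]
  simp_rw [k1, k2]
  rw [← j1, ← j2]

end IsCenteredNoise

end WaveletNoise

/-! ### Gaussian moment comparison. -/

namespace WaveletNoise

theorem eLpNorm_id_gaussianReal (v : ℝ≥0) (q : ℝ≥0∞) :
    eLpNorm id q (gaussianReal 0 v) = ‖√(v : ℝ)‖ₑ * eLpNorm id q (gaussianReal 0 1) := by
  have h : gaussianReal 0 v = (gaussianReal 0 1).map (√(v : ℝ) * ·) := by
    rw [gaussianReal_map_const_mul]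
    congr 1
    · simp
    · ext; simp
  rw [h, eLpNorm_map_measure (by fun_prop) (by fun_prop)]
  exact eLpNorm_const_smul (√(v : ℝ)) (id : ℝ → ℝ) q _

theorem eLpNorm_two_id_gaussianReal : eLpNorm id 2 (gaussianReal 0 1) = 1 := by
  have h := variance_id_gaussianReal (μ := 0) (v := 1)
  rw [variance_eq_integral (by fun_prop)] at h
  have h1 : eLpNorm (id : ℝ → ℝ) 2 (gaussianReal 0 1) ^ 2 = 1 := by
    rw [← lintegral_sq_eq_eLpNorm]
    have hi : Integrable (fun x : ℝ => x ^ 2) (gaussianReal 0 1) :=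
      (memLp_id_gaussianReal' 2 (by norm_num)).integrable_sq
    have := ofReal_integral_eq_lintegral_ofReal hi (ae_of_all _ fun x => sq_nonneg x)
    simp at h
    rw [h] at this
    simp only [ENNReal.ofReal_one] at this
    rw [this]
    congr 1 with x
    rw [← sq_abs, ENNReal.ofReal_pow (abs_nonneg _), ← Real.norm_eq_abs, ofReal_norm, id]
  have h3 : eLpNorm (id : ℝ → ℝ) 2 (gaussianReal 0 1) ^ 2 = 1 ^ 2 := by rw [h1, one_pow]
  exact (ENNReal.pow_right_strictMono two_ne_zero).injective h3

/-- The ratio of the `L^q` and `L²` norms of a centered Gaussian variable. -/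
noncomputable def gaussianMomentConst (q : ℝ≥0∞) : ℝ≥0∞ := eLpNorm id q (gaussianReal 0 1)

theorem gaussianMomentConst_ne_top {q : ℝ≥0∞} (hq : q ≠ ∞) : gaussianMomentConst q ≠ ∞ :=
  (memLp_id_gaussianReal' q hq).2.ne

variable {Ω : Type*} [MeasurableSpace Ω] {P : Measure Ω}

theorem eLpNorm_eq_of_hasLaw_gaussianReal {X : Ω → ℝ} {v : ℝ≥0} (h : HasLaw X (gaussianReal 0 v) P)
    (q : ℝ≥0∞) : eLpNorm X q P = gaussianMomentConst q * eLpNorm X 2 P := by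
  have e (r : ℝ≥0∞) : eLpNorm X r P = eLpNorm id r (gaussianReal 0 v) := by
    rw [← h.map_eq, eLpNorm_map_measure (by fun_prop) h.aemeasurable]
    rfl
  rw [e, e, eLpNorm_id_gaussianReal, eLpNorm_id_gaussianReal v 2, eLpNorm_two_id_gaussianReal,
    mul_one, gaussianMomentConst, mul_comm]

/-- The inequality between `L^q` and `L²` norms passes to closures in `L²`. -/
theorem eLpNorm_le_of_mem_closure {S : Set (Lp ℝ 2 P)} {q K : ℝ≥0∞}
    (hS : ∀ f ∈ S, eLpNorm f q P ≤ K * eLpNorm f 2 P) (hK : K ≠ ∞) {f : Lp ℝ 2 P}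
    (hf : f ∈ closure S) : eLpNorm f q P ≤ K * eLpNorm f 2 P := by
  -- Fatou in `L^q` along an almost everywhere convergent subsequence; the `L²` norms on the right
  -- converge.
  obtain ⟨u, hu, hlim⟩ := mem_closure_iff_seq_limit.1 hf
  obtain ⟨ns, hns, hae⟩ := (tendstoInMeasure_of_tendsto_Lp hlim).exists_seq_tendsto_ae
  refine (Lp.eLpNorm_lim_le_liminf_eLpNorm (fun n => Lp.aestronglyMeasurable (u (ns n))) _
    hae).trans ?_
  have h2 : Tendsto (fun n => K * eLpNorm (u (ns n)) 2 P) atTop (𝓝 (K * eLpNorm f 2 P)) := by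
    refine ENNReal.Tendsto.const_mul ?_ (Or.inr hK)
    simp_rw [← Lp.enorm_def]
    exact ((hlim.comp hns.tendsto_atTop).enorm)
  rw [← h2.liminf_eq]
  exact liminf_le_liminf (Eventually.of_forall fun n => hS _ (hu _))

namespace IsCenteredNoise

variable {Z : ℝ → Ω → ℝ} {p : ℝ → ℝ} {V : ℝ≥0∞}

theorem memLp_integral [IsFiniteMeasure P] (h : IsCenteredNoise P Z p V) {g : ℝ → ℂ}
    (hg : Integrable g) : MemLp (fun ω => ∫ τ, (Z τ ω : ℂ) * g τ) 2 P := by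
  refine ⟨(h.integrable_mul_complex hg).integral_prod_left.aestronglyMeasurable, ?_⟩
  have h1 := h.lintegral_sq_integral hg
  have h2 : ∫⁻ x, ‖fourierHat g x‖ₑ ^ 2 * ENNReal.ofReal (p x) < ∞ := by
    calc _ ≤ ∫⁻ x, ENNReal.ofReal (∫ t, ‖g t‖) ^ 2 * ENNReal.ofReal (p x) := by
          refine lintegral_mono fun x => ?_
          rw [← ofReal_norm]
          gcongr
          exact norm_fourierHat_le x
      _ < ∞ := by
          rw [lintegral_const_mul' _ _ (by finiteness)]
          exact ENNReal.mul_lt_top (by finiteness) h.integrable.lintegral_lt_top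
  rw [← h1, lintegral_sq_eq_eLpNorm] at h2
  by_contra hcon
  rw [not_lt, top_le_iff] at hcon
  rw [hcon] at h2
  simp at h2

theorem integral_ofReal_mul {Ω' : Type*} (Z : ℝ → Ω' → ℝ) (g : ℝ → ℝ) (ω : Ω') :
    ∫ τ, (Z τ ω : ℂ) * (g τ : ℂ) = ((∫ τ, Z τ ω * g τ : ℝ) : ℂ) := by
  rw [← integral_complex_ofReal]
  simp

theorem memLp_integral_real [IsFiniteMeasure P] (h : IsCenteredNoise P Z p V) {g : ℝ → ℝ}
    (hg : Integrable g) : MemLp (fun ω => ∫ τ, Z τ ω * g τ) 2 P := by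
  have := (h.memLp_integral hg.ofReal).re
  simp_rw [Complex.coe_algebraMap, integral_ofReal_mul] at this
  simpa using this

/-- `∫ Z τ * g τ dτ` lies in the closed span of the variables `Z τ` in `L²`. -/
theorem integral_mem_closure_span [IsFiniteMeasure P] (h : IsCenteredNoise P Z p V) {g : ℝ → ℝ}
    (hg : Integrable g) : (h.memLp_integral_real hg).toLp _ ∈
      (Submodule.span ℝ (range fun t => (h.memLp t).toLp (Z t))).topologicalClosure := by
  -- The closed span is the double orthogonal complement, so it suffices that every `y` orthogonal
  -- to all `Z t` is orthogonal to the integral, which is Fubini.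
  rw [← Submodule.orthogonal_orthogonal_eq_closure, Submodule.mem_orthogonal]
  intro y hy
  have hy' : ∀ t, ∫ ω, y ω * Z t ω ∂P = 0 := by
    intro t
    have := (Submodule.mem_orthogonal' _ _).1 hy _ (Submodule.subset_span ⟨t, rfl⟩)
    rw [L2.inner_def] at this
    rw [← this]
    refine integral_congr_ae ?_
    filter_upwards [(h.memLp t).coeFn_toLp] with ω hω
    rw [hω]
    simp [mul_comm]
  rw [L2.inner_def]
  have e : ∫ ω, inner ℝ (y ω) ((h.memLp_integral_real hg).toLp _ ω) ∂P =
      ∫ ω, (∫ τ, y ω * (Z τ ω * g τ)) ∂P := by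
    refine integral_congr_ae ?_
    filter_upwards [(h.memLp_integral_real hg).coeFn_toLp] with ω hω
    rw [hω, integral_const_mul]
    simp [mul_comm]
  rw [e, integral_integral_swap (f := fun ω τ => y ω * (Z τ ω * g τ))
    (h.integrable_mul_mul (Lp.memLp y) hg)]
  simp_rw [← mul_assoc, integral_mul_const, hy']
  simp

theorem eLpNorm_span_le (h : IsCenteredNoise P Z p V) (q : ℝ≥0∞) {f : Lp ℝ 2 P}
    (hf : f ∈ Submodule.span ℝ (range fun t => (h.memLp t).toLp (Z t))) :
    eLpNorm f q P ≤ gaussianMomentConst q * eLpNorm f 2 P := by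
  obtain ⟨c, rfl⟩ := Finsupp.mem_span_range_iff_exists_finsupp.1 hf
  obtain ⟨v, hv⟩ := h.gaussian c.support c
  have hae : (c.sum fun t a => a • (h.memLp t).toLp (Z t) : Lp ℝ 2 P) =ᵐ[P]
      fun ω => ∑ t ∈ c.support, c t * Z t ω := by
    rw [Finsupp.sum]
    have h2 : ∀ᵐ ω ∂P, ∀ t ∈ c.support, (c t • (h.memLp t).toLp (Z t) : Lp ℝ 2 P) ω =
        c t * Z t ω := by
      refine (ae_ball_iff c.support.countable_toSet).2 fun t _ => ?_
      filter_upwards [Lp.coeFn_smul (c t) ((h.memLp t).toLp (Z t)), (h.memLp t).coeFn_toLp]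
        with ω h3 h4
      rw [h3, Pi.smul_apply, h4, smul_eq_mul]
    filter_upwards [Lp.coeFn_finsetSum c.support (fun t => c t • (h.memLp t).toLp (Z t)), h2]
      with ω h3 h4
    rw [h3, Finset.sum_apply]
    exact Finset.sum_congr rfl h4
  rw [eLpNorm_congr_ae hae, eLpNorm_congr_ae hae]
  exact (eLpNorm_eq_of_hasLaw_gaussianReal hv q).le

/-- The moment comparison passes from the span to its `L²` closure, so the law of the integral
itself never has to be identified. -/
theorem eLpNorm_integral_real_le [IsFiniteMeasure P] (h : IsCenteredNoise P Z p V) {g : ℝ → ℝ}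
    (hg : Integrable g) {q : ℝ≥0∞} (hq : q ≠ ∞) :
    eLpNorm (fun ω => ∫ τ, Z τ ω * g τ) q P ≤
      gaussianMomentConst q * eLpNorm (fun ω => ∫ τ, Z τ ω * g τ) 2 P := by
  have := eLpNorm_le_of_mem_closure (q := q) (fun f hf => h.eLpNorm_span_le q hf)
    (gaussianMomentConst_ne_top hq) (h.integral_mem_closure_span hg)
  rwa [eLpNorm_congr_ae (h.memLp_integral_real hg).coeFn_toLp,
    eLpNorm_congr_ae (h.memLp_integral_real hg).coeFn_toLp] at this

/-- Real and imaginary parts are treated separately, whence the factor `2`; no joint law is needed.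
-/
theorem eLpNorm_integral_le [IsFiniteMeasure P] (h : IsCenteredNoise P Z p V) {g : ℝ → ℂ}
    (hg : Integrable g) {q : ℝ≥0∞} (hq : q ≠ ∞) (hq1 : 1 ≤ q) :
    eLpNorm (fun ω => ∫ τ, (Z τ ω : ℂ) * g τ) q P ≤
      2 * gaussianMomentConst q * eLpNorm (fun ω => ∫ τ, (Z τ ω : ℂ) * g τ) 2 P := by
  have hm := (h.memLp_integral_real hg.re).1
  have hm' := (h.memLp_integral_real hg.im).1
  have hre : ∀ᵐ ω ∂P, (∫ τ, (Z τ ω : ℂ) * g τ).re = ∫ τ, Z τ ω * (g τ).re ∧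
      (∫ τ, (Z τ ω : ℂ) * g τ).im = ∫ τ, Z τ ω * (g τ).im := by
    filter_upwards [(h.integrable_mul_complex hg).prod_right_ae] with ω hω
    have h1 := integral_re hω
    have h2 := integral_im hω
    constructor
    · simpa using h1.symm
    · simpa using h2.symm
  have b1 : eLpNorm (fun ω => ∫ τ, Z τ ω * (g τ).re) 2 P ≤
      eLpNorm (fun ω => ∫ τ, (Z τ ω : ℂ) * g τ) 2 P := by
    refine eLpNorm_mono_ae ?_
    filter_upwards [hre] with ω hω
    rw [← hω.1]
    exact Complex.abs_re_le_norm _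
  have b2 : eLpNorm (fun ω => ∫ τ, Z τ ω * (g τ).im) 2 P ≤
      eLpNorm (fun ω => ∫ τ, (Z τ ω : ℂ) * g τ) 2 P := by
    refine eLpNorm_mono_ae ?_
    filter_upwards [hre] with ω hω
    rw [← hω.2]
    exact Complex.abs_im_le_norm _
  have c1 := h.eLpNorm_integral_real_le hg.re hq
  have c2 := h.eLpNorm_integral_real_le hg.im hq
  simp only [RCLike.re_to_complex, RCLike.im_to_complex] at c1 c2 hm hm'
  calc eLpNorm (fun ω => ∫ τ, (Z τ ω : ℂ) * g τ) q P
      ≤ eLpNorm ((fun ω => ‖∫ τ, Z τ ω * (g τ).re‖) + fun ω => ‖∫ τ, Z τ ω * (g τ).im‖) q P := by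
        refine eLpNorm_mono_ae_real ?_
        filter_upwards [hre] with ω hω
        rw [Pi.add_apply, ← hω.1, ← hω.2]
        exact Complex.norm_le_abs_re_add_abs_im _
    _ ≤ _ := eLpNorm_add_le hm.norm hm'.norm hq1
    _ ≤ gaussianMomentConst q * eLpNorm (fun ω => ∫ τ, (Z τ ω : ℂ) * g τ) 2 P +
        gaussianMomentConst q * eLpNorm (fun ω => ∫ τ, (Z τ ω : ℂ) * g τ) 2 P := by
        rw [eLpNorm_norm, eLpNorm_norm]
        exact add_le_add (c1.trans (by gcongr)) (c2.trans (by gcongr))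
    _ = _ := by ring

/-- Gaussian moment bound for `∫ Z τ * g τ dτ` in terms of the spectral density. -/
theorem lintegral_pow_integral_le [IsFiniteMeasure P] (h : IsCenteredNoise P Z p V) {g : ℝ → ℂ}
    (hg : Integrable g) {k : ℕ} (hk : k ≠ 0) :
    ∫⁻ ω, ‖∫ τ, (Z τ ω : ℂ) * g τ‖ₑ ^ (2 * k) ∂P ≤
      (2 * gaussianMomentConst (2 * k : ℕ)) ^ (2 * k) *
        (∫⁻ x, ‖fourierHat g x‖ₑ ^ 2 * ENNReal.ofReal (p x)) ^ k := by
  have hk1 : 1 ≤ 2 * k := by omega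
  have h1 := h.eLpNorm_integral_le hg (q := (2 * k : ℕ)) (ENNReal.natCast_ne_top _)
    (by exact_mod_cast hk1)
  rw [← h.lintegral_sq_integral hg, lintegral_sq_eq_eLpNorm, ← pow_mul, ← mul_pow]
  refine le_trans (le_of_eq ?_) (pow_le_pow_left' h1 (2 * k))
  rw [eLpNorm_eq_lintegral_rpow_enorm_toReal (by exact_mod_cast (by omega : 2 * k ≠ 0))
    (ENNReal.natCast_ne_top _), ← ENNReal.rpow_natCast, ← ENNReal.rpow_mul]
  rw [ENNReal.toReal_natCast, one_div_mul_cancel (by positivity), ENNReal.rpow_one]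
  simp_rw [ENNReal.rpow_natCast]

end IsCenteredNoise

end WaveletNoise

/-! ### Decay of the variance at small and large scales. -/

namespace WaveletNoise

/-- The variance of the wavelet transform at scale `s` of a noise with spectral density `p`. -/
noncomputable def scaleVariance (ψ : ℝ → ℂ) (p : ℝ → ℝ) (s : ℝ) : ℝ≥0∞ :=
  ∫⁻ x, ‖fourierHat ψ (s * x)‖ₑ ^ 2 * ENNReal.ofReal (p x)

theorem lintegral_fourierHat_waveletAtom (ψ : ℝ → ℂ) (p : ℝ → ℝ) (t : ℝ) {s : ℝ} (hs : 0 < s) :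
    ∫⁻ x, ‖fourierHat (waveletAtom ψ t s) x‖ₑ ^ 2 * ENNReal.ofReal (p x) =
      scaleVariance ψ p s := by
  unfold scaleVariance
  congr 1 with x
  rw [fourierHat_waveletAtom _ _ hs, enorm_mul, ← ofReal_norm, norm_exp_neg_I_mul]
  simp

theorem enorm_sq_mul_ofReal (z : ℂ) (r : ℝ) :
    ‖z‖ₑ ^ 2 * ENNReal.ofReal r = ENNReal.ofReal (‖z‖ ^ 2 * r) := by
  rw [ENNReal.ofReal_mul (by positivity), ENNReal.ofReal_pow (norm_nonneg _), ofReal_norm]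

/-- Split at `|x| = s^(-1/2)`. Below, `|ψ̂(s x)| ≤ C s |x| ≤ C s^(1/2)`. Above, half of the excess
decay, `|x|^(-γ/2) ≤ s^(γ/4)`, pays for the rate and the other half keeps `|x|^(-(1+γ/2))`
integrable. -/
theorem exists_scaleVariance_le_of_spectralDecay {ψ : ℝ → ℂ} {p : ℝ → ℝ} {C : ℝ}
    (hψ : IsAnalyticWavelet ψ) (hC : HatBounds ψ C) (hp0 : ∀ x, 0 ≤ p x) (hp : Integrable p)
    (hdecay : SpectralDecay p) :
    ∃ (δ : ℝ) (A : ℝ≥0∞), 0 < δ ∧ A ≠ ∞ ∧ ∀ s, 0 < s → s ≤ 1 →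
      scaleVariance ψ p s ≤ ENNReal.ofReal (s ^ δ) * A := by
  obtain ⟨γ, C₁, hγ, hγ2, hC₁, hle⟩ := hdecay
  have hCp := hC.pos
  have hzero := hψ.analytic 0 le_rfl
  set J : ℝ → ℝ := fun x => C ^ 2 * p x + C ^ 2 * C₁ * 4 * (1 + |x|) ^ (-(1 + γ / 2)) with hJ
  refine ⟨γ / 4, ∫⁻ x, ENNReal.ofReal (J x), by positivity, ?_, fun s hs hs1 => ?_⟩
  · have h1 := integrable_one_add_norm (E := ℝ) (μ := volume) (r := 1 + γ / 2) (by simp; positivity)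
    simp only [Real.norm_eq_abs] at h1
    exact ((hp.const_mul (C ^ 2)).add (h1.const_mul (C ^ 2 * C₁ * 4))).lintegral_lt_top.ne
  unfold scaleVariance
  rw [← lintegral_const_mul' _ _ ENNReal.ofReal_ne_top]
  refine lintegral_mono fun x => ?_
  rw [enorm_sq_mul_ofReal, ← ENNReal.ofReal_mul (by positivity)]
  refine ENNReal.ofReal_le_ofReal ?_
  have hpx := hp0 x
  have hJ2 : 0 ≤ C ^ 2 * C₁ * 4 * (1 + |x|) ^ (-(1 + γ / 2)) := by positivity
  rcases le_or_gt |x| (s ^ (-(1 / 2) : ℝ)) with hx | hx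
  · have h1 : ‖fourierHat ψ (s * x)‖ ≤ C * (s * |x|) := by
      have := hC.lipschitz 0 (s * x)
      rwa [hzero, sub_zero, sub_zero, abs_mul, abs_of_pos hs] at this
    have h2 : s * |x| ≤ s ^ (1 / 2 : ℝ) := by
      calc s * |x| ≤ s ^ (1 : ℝ) * s ^ (-(1 / 2) : ℝ) := by rw [Real.rpow_one]; gcongr
        _ = _ := by rw [← Real.rpow_add hs]; norm_num
    have h3 : ‖fourierHat ψ (s * x)‖ ^ 2 ≤ C ^ 2 * s ^ (γ / 4) := by
      calc _ ≤ (C * s ^ (1 / 2 : ℝ)) ^ 2 := by gcongr; exact h1.trans (by gcongr)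
        _ = C ^ 2 * s ^ (1 : ℝ) := by
          rw [mul_pow, ← Real.rpow_natCast (s ^ (1 / 2 : ℝ)), ← Real.rpow_mul hs.le]; norm_num
        _ ≤ _ := by
          gcongr ?_ * ?_
          exact Real.rpow_le_rpow_of_exponent_ge hs hs1 (by linarith)
    calc _ ≤ C ^ 2 * s ^ (γ / 4) * p x := by gcongr
      _ = s ^ (γ / 4) * (C ^ 2 * p x) := by ring
      _ ≤ _ := by gcongr; simp only [hJ]; linarith
  · have hx1 : 1 ≤ |x| := by
      refine le_trans ?_ hx.le
      exact Real.one_le_rpow_of_pos_of_le_one_of_nonpos hs hs1 (by norm_num)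
    have hx0 : 0 < |x| := by linarith
    have h1 : ‖fourierHat ψ (s * x)‖ ≤ C := by
      refine (hC.decay _).trans (div_le_self hCp.le ?_)
      linarith [abs_nonneg (s * x)]
    have h2 : |x| ^ (-(γ / 2)) ≤ s ^ (γ / 4) := by
      calc _ ≤ (s ^ (-(1 / 2) : ℝ)) ^ (-(γ / 2)) :=
            Real.rpow_le_rpow_of_nonpos (by positivity) hx.le (by linarith)
        _ = _ := by rw [← Real.rpow_mul hs.le]; ring_nf
    -- Here `|x| ≥ (1 + |x|)/2` since `|x| ≥ 1`; the constant is `2^(1+γ/2) ≤ 4` because `γ < 2`.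
    have h3 : |x| ^ (-(1 + γ / 2)) ≤ 4 * (1 + |x|) ^ (-(1 + γ / 2)) := by
      calc _ ≤ ((1 + |x|) / 2) ^ (-(1 + γ / 2)) :=
            Real.rpow_le_rpow_of_nonpos (by positivity) (by linarith) (by linarith)
        _ = (1 / 2) ^ (-(1 + γ / 2)) * (1 + |x|) ^ (-(1 + γ / 2)) := by
            rw [← Real.mul_rpow (by positivity) (by positivity)]; ring_nf
        _ ≤ _ := by
            gcongr
            calc (1 / 2 : ℝ) ^ (-(1 + γ / 2)) ≤ (1 / 2 : ℝ) ^ (-2 : ℝ) :=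
                  Real.rpow_le_rpow_of_exponent_ge (by norm_num) (by norm_num) (by linarith)
              _ = 4 := by rw [Real.rpow_neg (by norm_num)]; norm_num
    have h4 : p x ≤ C₁ * (s ^ (γ / 4) * (4 * (1 + |x|) ^ (-(1 + γ / 2)))) := by
      calc p x ≤ C₁ * |x| ^ (-(1 + γ)) := hle x (abs_pos.1 hx0)
        _ = C₁ * (|x| ^ (-(γ / 2)) * |x| ^ (-(1 + γ / 2))) := by
            rw [← Real.rpow_add hx0]; ring_nf
        _ ≤ _ := by gcongr
    calc _ ≤ C ^ 2 * (C₁ * (s ^ (γ / 4) * (4 * (1 + |x|) ^ (-(1 + γ / 2))))) := by gcongr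
      _ = s ^ (γ / 4) * (C ^ 2 * C₁ * 4 * (1 + |x|) ^ (-(1 + γ / 2))) := by ring
      _ ≤ _ := by
        gcongr; simp only [hJ]
        have : 0 ≤ C ^ 2 * p x := by positivity
        linarith

/-- The spectral mass of the interval `[-x, x]`. -/
noncomputable def lowMass (p : ℝ → ℝ) (x : ℝ) : ℝ≥0∞ :=
  ∫⁻ y in {y | |y| ≤ x}, ENNReal.ofReal (p y)

theorem measurableSet_abs_le (x : ℝ) : MeasurableSet {y : ℝ | |y| ≤ x} :=
  measurableSet_le (by fun_prop) (by fun_prop)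

theorem lowMass_le_total (p : ℝ → ℝ) (x : ℝ) : lowMass p x ≤ ∫⁻ y, ENNReal.ofReal (p y) :=
  setLIntegral_le_lintegral _ _

theorem lowMass_mono (p : ℝ → ℝ) {x y : ℝ} (h : x ≤ y) : lowMass p x ≤ lowMass p y :=
  lintegral_mono_set fun _ hz => le_trans hz h

theorem exists_lowMass_le_of_shortRange {p : ℝ → ℝ} (h : ShortRangeDependence p) :
    ∃ (δ : ℝ) (A : ℝ≥0∞), 0 < δ ∧ A ≠ ∞ ∧ ∀ x, 0 < x → x ≤ 1 →
      lowMass p x ≤ ENNReal.ofReal (x ^ δ) * A := by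
  obtain ⟨⟨M, hM⟩, -⟩ := h
  refine ⟨1, ENNReal.ofReal M * 2, one_pos, by finiteness, fun x hx _ => ?_⟩
  calc lowMass p x ≤ ∫⁻ y in {y | |y| ≤ x}, ENNReal.ofReal M :=
        lintegral_mono fun y => ENNReal.ofReal_le_ofReal (hM y)
    _ = ENNReal.ofReal M * ENNReal.ofReal (2 * x) := by
        rw [setLIntegral_const]
        congr 1
        have : {y : ℝ | |y| ≤ x} = Icc (-x) x := by ext y; simp [abs_le]
        rw [this, Real.volume_Icc]
        ring_nf
    _ = _ := by
        rw [Real.rpow_one, ENNReal.ofReal_mul (by norm_num)]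
        simp only [ENNReal.ofReal_ofNat]
        ring

/-- The substitution `y ↦ y/2` contributes the factor `1/2`. Iterating over dyadic scales produces a
power law as soon as `ρ < 2`. -/
theorem lowMass_half_le {p : ℝ → ℝ} {x₀ ρ : ℝ} (hρ : 0 ≤ ρ)
    (h : ∀ x, x ≠ 0 → |x| ≤ x₀ → p (2⁻¹ * x) ≤ ρ * p x) {x : ℝ} (hx : x ≤ x₀) :
    lowMass p (2⁻¹ * x) ≤ ENNReal.ofReal (ρ / 2) * lowMass p x := by
  unfold lowMass
  rw [← lintegral_indicator (measurableSet_abs_le _), ← lintegral_indicator (measurableSet_abs_le _)]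
  have e := lintegral_comp_const_mul
    ({y : ℝ | |y| ≤ 2⁻¹ * x}.indicator fun y => ENNReal.ofReal (p y)) (a := 2⁻¹) (by norm_num)
  have h2 : ∫⁻ y, {y : ℝ | |y| ≤ 2⁻¹ * x}.indicator (fun y => ENNReal.ofReal (p y)) (2⁻¹ * y) ≤
      ENNReal.ofReal ρ * ∫⁻ y, {y : ℝ | |y| ≤ x}.indicator (fun y => ENNReal.ofReal (p y)) y := by
    rw [← lintegral_const_mul' _ _ ENNReal.ofReal_ne_top]
    refine lintegral_mono_ae ?_
    filter_upwards [compl_mem_ae_iff.2 (measure_singleton (0 : ℝ))] with y hy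
    have hy0 : y ≠ 0 := hy
    by_cases hyx : |y| ≤ x
    · rw [indicator_of_mem (show y ∈ {y : ℝ | |y| ≤ x} from hyx), ← ENNReal.ofReal_mul hρ]
      refine (indicator_le_self _ _ _).trans ?_
      exact ENNReal.ofReal_le_ofReal (h y hy0 (hyx.trans hx))
    · rw [indicator_of_notMem]
      · exact zero_le
      · simp only [mem_ofPred_eq, abs_mul]
        norm_num
        linarith
  rw [e] at h2
  have h3 : ENNReal.ofReal |(2⁻¹ : ℝ)⁻¹| = 2 := by norm_num
  rw [h3] at h2
  calc _ = 2⁻¹ * (2 * ∫⁻ y, {y : ℝ | |y| ≤ 2⁻¹ * x}.indicator (fun y => ENNReal.ofReal (p y)) y) := by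
        rw [← mul_assoc, ENNReal.inv_mul_cancel (by norm_num) (by norm_num), one_mul]
    _ ≤ 2⁻¹ * (ENNReal.ofReal ρ * _) := by gcongr
    _ = _ := by
        rw [← mul_assoc, div_eq_inv_mul, ENNReal.ofReal_mul (by norm_num),
          ENNReal.ofReal_inv_of_pos (by norm_num)]
        simp

theorem exists_lowMass_le_of_longRange {p : ℝ → ℝ} (hp : Integrable p)
    (h : LongRangeDependence p) :
    ∃ (δ : ℝ) (A : ℝ≥0∞), 0 < δ ∧ A ≠ ∞ ∧ ∀ x, 0 < x → x ≤ 1 →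
      lowMass p x ≤ ENNReal.ofReal (x ^ δ) * A := by
  obtain ⟨H, L, hH, hH1, hL, hev⟩ := h
  rw [eventually_nhdsWithin_iff, Metric.eventually_nhds_iff] at hev
  obtain ⟨x₁, hx₁, hev⟩ := hev
  -- Only the ratio at `c = 2` matters. Eventually `L(2r) ≤ 2^(H/2) L(r)`, hence `p(x/2) ≤ 2^(H/2)
  -- 2^(1-H) p(x)` near the origin, and the mass contracts by `q = 2^(-H/2)` at each halving.
  have h2 := (hL.slowly 2 two_pos).eventually_le_const
    (Real.one_lt_rpow (x := 2) (z := H / 2) (by norm_num) (by positivity))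
  obtain ⟨r₀, hr₀⟩ := eventually_atTop.1 h2
  set r := max r₀ 1 with hr
  have hr1 : 1 ≤ r := le_max_right _ _
  set x₀ := min (x₁ / 2) r⁻¹ with hx₀
  have hx₀p : 0 < x₀ := lt_min (by positivity) (by positivity)
  have hstep : ∀ x, x ≠ 0 → |x| ≤ x₀ → p (2⁻¹ * x) ≤ 2 ^ (1 - H / 2) * p x := by
    intro x hx0 hx
    have hxa : 0 < |x| := abs_pos.2 hx0
    have hxx1 : |x| ≤ x₁ / 2 := hx.trans (min_le_left _ _)
    have hxr : r ≤ |x|⁻¹ := le_inv_of_le_inv₀ (by positivity) (hx.trans (min_le_right _ _))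
    have e1 := hev (y := x) (by rw [dist_zero_right, Real.norm_eq_abs]; linarith) hx0
    have e2 := hev (y := 2⁻¹ * x) (by
      rw [dist_zero_right, Real.norm_eq_abs, abs_mul, abs_of_pos (by norm_num : (0 : ℝ) < 2⁻¹)]
      linarith) (by simpa using hx0)
    have hLp := hL.pos |x|⁻¹ (by positivity)
    have hLe := hr₀ |x|⁻¹ ((le_max_left _ _).trans hxr)
    rw [div_le_iff₀ hLp] at hLe
    rw [e1, e2, abs_mul, abs_of_pos (by norm_num : (0 : ℝ) < 2⁻¹), mul_inv, inv_inv,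
      Real.mul_rpow (by norm_num) hxa.le]
    calc L (2 * |x|⁻¹) * ((2⁻¹ : ℝ) ^ (H - 1) * |x| ^ (H - 1)) ≤
          (2 ^ (H / 2) * L |x|⁻¹) * ((2⁻¹ : ℝ) ^ (H - 1) * |x| ^ (H - 1)) := by gcongr
      _ = (2 ^ (H / 2) * (2⁻¹ : ℝ) ^ (H - 1)) * (L |x|⁻¹ * |x| ^ (H - 1)) := by ring
      _ = _ := by
          rw [Real.inv_rpow (by norm_num), ← Real.rpow_neg (by norm_num),
            ← Real.rpow_add (by norm_num)]
          ring_nf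
  set q : ℝ := 2⁻¹ ^ (H / 2) with hq
  have hq0 : 0 < q := by positivity
  have hqe : (2 : ℝ) ^ (1 - H / 2) / 2 = q := by
    rw [hq, Real.inv_rpow (by norm_num), ← Real.rpow_neg (by norm_num), Real.rpow_sub (by norm_num),
      Real.rpow_neg (by norm_num)]
    norm_num
    ring
  set T := ∫⁻ y, ENNReal.ofReal (p y) with hT
  have hTt : T ≠ ∞ := hp.lintegral_lt_top.ne
  have hpow : ∀ k : ℕ, lowMass p (2⁻¹ ^ k * x₀) ≤ ENNReal.ofReal (q ^ k) * T := by
    intro k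
    induction k with
    | zero => simpa using lowMass_le_total p x₀
    | succ k ih =>
      have := lowMass_half_le (by positivity) hstep (x := 2⁻¹ ^ k * x₀)
        (mul_le_of_le_one_left hx₀p.le (pow_le_one₀ (by norm_num) (by norm_num)))
      rw [hqe] at this
      rw [pow_succ', mul_assoc, pow_succ', ENNReal.ofReal_mul hq0.le, mul_assoc]
      exact this.trans (by gcongr)
  -- The factor `2 / x₀` covers the dyadic rounding `2^(-(k+1)) x₀ < x`, and makes the bound trivial
  -- when `x > x₀`.
  refine ⟨H / 2, ENNReal.ofReal ((2 / x₀) ^ (H / 2)) * T, by positivity, by finiteness,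
    fun x hx _ => ?_⟩
  rw [← mul_assoc, ← ENNReal.ofReal_mul (by positivity), ← Real.mul_rpow hx.le (by positivity)]
  rcases le_or_gt x x₀ with hxx | hxx
  · obtain ⟨k, hk1, hk2⟩ := exists_nat_pow_near_of_lt_one (x := x / x₀) (y := (2⁻¹ : ℝ))
      (by positivity) ((div_le_one hx₀p).2 hxx) (by norm_num) (by norm_num)
    have hk3 : x ≤ 2⁻¹ ^ k * x₀ := by rwa [div_le_iff₀ hx₀p] at hk2
    refine (lowMass_mono p hk3).trans ((hpow k).trans ?_)
    gcongr
    have : (2⁻¹ : ℝ) ^ k ≤ x * (2 / x₀) := by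
      rw [pow_succ, lt_div_iff₀ hx₀p] at hk1
      rw [mul_div_assoc', le_div_iff₀ hx₀p]
      linarith
    calc q ^ k = ((2⁻¹ : ℝ) ^ k) ^ (H / 2) := by
          rw [hq, ← Real.rpow_natCast, ← Real.rpow_natCast, ← Real.rpow_mul (by norm_num),
            ← Real.rpow_mul (by norm_num), mul_comm]
      _ ≤ _ := by gcongr
  · refine (lowMass_le_total p x).trans (le_mul_of_one_le_left zero_le ?_)
    rw [ENNReal.one_le_ofReal]
    refine Real.one_le_rpow ?_ (by positivity)
    rw [mul_div_assoc', le_div_iff₀ hx₀p]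
    linarith

/-- Split at `|x| = s^(-1/2)`. Inside, `ψ̂` is bounded and the low-frequency mass is of order
`s^(-δ/2)`; outside, `s|x| > s^(1/2)` gives `|ψ̂(s x)|² ≤ C² / s`. The exponent is the smaller of
the two. -/
theorem exists_scaleVariance_le_of_lowMass {ψ : ℝ → ℂ} {p : ℝ → ℝ} {C : ℝ}
    (hC : HatBounds ψ C) (hp : Integrable p)
    (hlow : ∃ (δ : ℝ) (A : ℝ≥0∞), 0 < δ ∧ A ≠ ∞ ∧ ∀ x, 0 < x → x ≤ 1 →
      lowMass p x ≤ ENNReal.ofReal (x ^ δ) * A) :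
    ∃ (δ : ℝ) (A : ℝ≥0∞), 0 < δ ∧ A ≠ ∞ ∧ ∀ s, 1 ≤ s →
      scaleVariance ψ p s ≤ ENNReal.ofReal (s ^ (-δ)) * A := by
  obtain ⟨δ, A, hδ, hA, hlow⟩ := hlow
  have hCp := hC.pos
  set T := ∫⁻ y, ENNReal.ofReal (p y) with hT
  have hTt : T ≠ ∞ := hp.lintegral_lt_top.ne
  set ε := min (δ / 2) 1 with hε
  refine ⟨ε, ENNReal.ofReal (C ^ 2) * (A + T), lt_min (by positivity) one_pos, by finiteness,
    fun s hs => ?_⟩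
  have hs0 : 0 < s := by linarith
  set x₀ := s ^ (-(1 / 2) : ℝ) with hx₀
  have hx₀p : 0 < x₀ := by positivity
  have hx₀1 : x₀ ≤ 1 := Real.rpow_le_one_of_one_le_of_nonpos hs (by norm_num)
  have hms := measurableSet_abs_le x₀
  unfold scaleVariance
  rw [← lintegral_add_compl _ hms]
  have h1 : ∫⁻ x in {y | |y| ≤ x₀}, ‖fourierHat ψ (s * x)‖ₑ ^ 2 * ENNReal.ofReal (p x) ≤
      ENNReal.ofReal (C ^ 2) * (ENNReal.ofReal (s ^ (-ε)) * A) := by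
    calc _ ≤ ∫⁻ x in {y | |y| ≤ x₀}, ENNReal.ofReal (C ^ 2) * ENNReal.ofReal (p x) := by
          refine lintegral_mono fun x => ?_
          rw [← ofReal_norm, ← ENNReal.ofReal_pow (norm_nonneg _)]
          gcongr
          refine (hC.decay _).trans (div_le_self hCp.le ?_)
          linarith [abs_nonneg (s * x)]
      _ = ENNReal.ofReal (C ^ 2) * lowMass p x₀ := lintegral_const_mul' _ _ ENNReal.ofReal_ne_top
      _ ≤ _ := by
          gcongr
          refine (hlow x₀ hx₀p hx₀1).trans ?_
          gcongr
          rw [hx₀, ← Real.rpow_mul hs0.le]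
          refine Real.rpow_le_rpow_of_exponent_le hs ?_
          have := min_le_left (δ / 2) 1
          linarith
  have h2 : ∫⁻ x in {y | |y| ≤ x₀}ᶜ, ‖fourierHat ψ (s * x)‖ₑ ^ 2 * ENNReal.ofReal (p x) ≤
      ENNReal.ofReal (C ^ 2) * (ENNReal.ofReal (s ^ (-ε)) * T) := by
    calc _ ≤ ∫⁻ x in {y | |y| ≤ x₀}ᶜ, ENNReal.ofReal (C ^ 2 * s ^ (-ε)) * ENNReal.ofReal (p x) := by
          refine setLIntegral_mono_ae' hms.compl (ae_of_all _ fun x hx => ?_)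
          rw [← ofReal_norm, ← ENNReal.ofReal_pow (norm_nonneg _)]
          gcongr
          have hx' : x₀ < |x| := not_le.1 hx
          have hd : ‖fourierHat ψ (s * x)‖ ≤ C * s ^ (-(1 / 2) : ℝ) := by
            refine (hC.decay _).trans ?_
            rw [div_le_iff₀ (by positivity), mul_assoc]
            refine le_mul_of_one_le_right hCp.le ?_
            rw [abs_mul, abs_of_pos hs0]
            calc (1 : ℝ) = s ^ (-(1 / 2) : ℝ) * (s ^ (1 : ℝ) * s ^ (-(1 / 2) : ℝ)) := by
                  rw [← Real.rpow_add hs0, ← Real.rpow_add hs0]; norm_num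
              _ ≤ s ^ (-(1 / 2) : ℝ) * (1 + s * |x|) := by
                  gcongr
                  rw [Real.rpow_one]
                  have : s * x₀ ≤ s * |x| := by gcongr
                  linarith
          calc _ ≤ (C * s ^ (-(1 / 2) : ℝ)) ^ 2 := by gcongr
            _ = C ^ 2 * s ^ (-1 : ℝ) := by
                rw [mul_pow, ← Real.rpow_natCast (s ^ (-(1 / 2) : ℝ)), ← Real.rpow_mul hs0.le]
                norm_num
            _ ≤ _ := by
                gcongr ?_ * ?_
                refine Real.rpow_le_rpow_of_exponent_le hs ?_
                have := min_le_right (δ / 2) 1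
                linarith
      _ ≤ ∫⁻ x, ENNReal.ofReal (C ^ 2 * s ^ (-ε)) * ENNReal.ofReal (p x) :=
          setLIntegral_le_lintegral _ _
      _ = _ := by
          rw [lintegral_const_mul' _ _ ENNReal.ofReal_ne_top, ENNReal.ofReal_mul (by positivity),
            mul_assoc]
  calc _ ≤ _ := add_le_add h1 h2
    _ = _ := by ring

end WaveletNoise

/-! ### From moments on a grid to almost sure convergence. -/

namespace WaveletNoise

variable {Ω : Type*} [MeasurableSpace Ω] {P : Measure Ω}

/-- The sum of the values of `F` over a grid of mesh `(n + 1)⁻³²` in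
`[-(n + 1), n + 1] × [n + 1, n + 2]`. -/
noncomputable def gridSum (F : ℝ → ℝ → ℝ≥0∞) (n : ℕ) : ℝ≥0∞ :=
  ∑ j ∈ Finset.Icc (-((n + 1) ^ 33 : ℤ)) ((n + 1) ^ 33),
    ∑ i ∈ Finset.range ((n + 1) ^ 32 + 1),
      F (j / (n + 1) ^ 32) ((n + 1) + i / (n + 1) ^ 32)

theorem gridSum_le {F : ℝ → ℝ → ℝ≥0∞} {n : ℕ} {B : ℝ≥0∞}
    (h : ∀ t u : ℝ, (n : ℝ) + 1 ≤ u → F t u ≤ B) :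
    gridSum F n ≤ ENNReal.ofReal (6 * ((n : ℝ) + 1) ^ 65) * B := by
  have h1 : gridSum F n ≤ ∑ j ∈ Finset.Icc (-((n + 1) ^ 33 : ℤ)) ((n + 1) ^ 33),
    ∑ i ∈ Finset.range ((n + 1) ^ 32 + 1), B :=
    Finset.sum_le_sum fun j _ => Finset.sum_le_sum fun i _ => h _ _ (by
      have : (0 : ℝ) ≤ i / ((n : ℝ) + 1) ^ 32 := by positivity
      linarith)
  refine h1.trans ?_
  rw [Finset.sum_const, Finset.sum_const, Finset.card_range, smul_smul, nsmul_eq_mul]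
  gcongr
  rw [← ENNReal.ofReal_natCast]
  refine ENNReal.ofReal_le_ofReal ?_
  have hc : (Finset.Icc (-((n + 1) ^ 33 : ℤ)) ((n + 1) ^ 33)).card = 2 * (n + 1) ^ 33 + 1 := by
    rw [Int.card_Icc]
    zify
    have h0 : (0 : ℤ) ≤ ((n : ℤ) + 1) ^ 33 := by positivity
    rw [Int.toNat_of_nonneg (by linarith)]
    ring
  rw [hc]
  push_cast
  have hb1 : 1 ≤ (n : ℝ) + 1 := by linarith [(Nat.cast_nonneg n : (0 : ℝ) ≤ n)]
  generalize (n : ℝ) + 1 = b at hb1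
  have e1 : 1 ≤ b ^ 33 := one_le_pow₀ hb1
  have e2 : 1 ≤ b ^ 32 := one_le_pow₀ hb1
  calc (2 * b ^ 33 + 1) * (b ^ 32 + 1) ≤ (2 * b ^ 33 + b ^ 33) * (b ^ 32 + b ^ 32) :=
        mul_le_mul (by linarith) (by linarith) (by positivity) (by positivity)
    _ = 6 * b ^ 65 := by ring

/-- Both coordinates are rounded down to the grid. The margin `|t| ≤ ⌊u⌋₊ - 1` keeps the rounded
time inside the box, and the box starting at height `⌊u⌋₊` has index `⌊u⌋₊ - 1`. -/
theorem le_gridSum (F : ℝ → ℝ → ℝ≥0∞) {t u : ℝ} (ht : |t| ≤ ⌊u⌋₊ - 1) (hu : 1 ≤ u) :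
    ∃ t' u' : ℝ, F t' u' ≤ gridSum F (⌊u⌋₊ - 1) ∧ |t'| ≤ ⌊u⌋₊ ∧ (⌊u⌋₊ : ℝ) ≤ u' ∧
      u' ≤ ⌊u⌋₊ + 1 ∧ |t - t'| + |u - u'| ≤ 2 / (⌊u⌋₊ : ℝ) ^ 32 := by
  obtain ⟨n, hn⟩ : ∃ n, ⌊u⌋₊ = n + 1 := Nat.exists_eq_succ_of_ne_zero (Nat.floor_pos.2 hu).ne'
  have hu1 : (n : ℝ) + 1 ≤ u := by
    have := Nat.floor_le (zero_le_one.trans hu); rw [hn] at this; exact_mod_cast this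
  have hu2 : u < (n : ℝ) + 1 + 1 := by
    have := Nat.lt_floor_add_one u; rw [hn] at this; exact_mod_cast this
  rw [hn] at ht ⊢
  push_cast at ht ⊢
  set b : ℝ := (n : ℝ) + 1 with hb
  have hb1 : 1 ≤ b := by rw [hb]; linarith [(Nat.cast_nonneg n : (0 : ℝ) ≤ n)]
  set l : ℝ := b ^ 32 with hl
  have hl1 : 1 ≤ l := one_le_pow₀ hb1
  have hl0 : 0 < l := by linarith
  have hbl : b ^ 33 = b * l := by rw [hl]; ring
  have f1 := Int.floor_le (t * l)
  have f2 := Int.lt_floor_add_one (t * l)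
  have g0 : 0 ≤ (u - b) * l := mul_nonneg (by linarith) hl0.le
  have g1 := Nat.floor_le g0
  have g2 := Nat.lt_floor_add_one ((u - b) * l)
  have ht1 : t * l ≤ (b - 1) * l := by gcongr; exact (le_abs_self t).trans ht
  have ht2 : -((b - 1) * l) ≤ t * l := by
    rw [← neg_mul]; gcongr; exact neg_le_of_abs_le ht
  have j1 : (⌊t * l⌋ : ℝ) ≤ b * l := by linarith
  have j2 : -(b * l) ≤ (⌊t * l⌋ : ℝ) := by linarith
  have i1 : (⌊(u - b) * l⌋₊ : ℝ) ≤ l := by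
    refine g1.trans (mul_le_of_le_one_left hl0.le (by linarith))
  refine ⟨⌊t * l⌋ / l, b + ⌊(u - b) * l⌋₊ / l, ?_, ?_, ?_, ?_, ?_⟩
  · unfold gridSum
    have hj : ⌊t * l⌋ ∈ Finset.Icc (-((n + 1) ^ 33 : ℤ)) ((n + 1) ^ 33) := by
      rw [Finset.mem_Icc]
      rw [← hbl, hb] at j1 j2
      constructor
      · exact_mod_cast j2
      · exact_mod_cast j1
    have hi : ⌊(u - b) * l⌋₊ ∈ Finset.range ((n + 1) ^ 32 + 1) := by
      rw [Finset.mem_range, Nat.lt_succ_iff]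
      have i2 : (⌊(u - b) * l⌋₊ : ℝ) ≤ ((n + 1) ^ 32 : ℕ) := by push_cast; exact i1
      exact Nat.cast_le.1 i2
    refine le_trans ?_ (Finset.single_le_sum (f := fun j : ℤ =>
      ∑ i ∈ Finset.range ((n + 1) ^ 32 + 1), F (j / (n + 1) ^ 32) ((n + 1) + i / (n + 1) ^ 32))
      (fun _ _ => zero_le) hj)
    exact Finset.single_le_sum (f := fun i : ℕ =>
      F (⌊t * l⌋ / (n + 1) ^ 32) ((n + 1) + i / (n + 1) ^ 32)) (fun _ _ => zero_le) hi
  · rw [abs_div, abs_of_pos hl0, div_le_iff₀ hl0, abs_le]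
    exact ⟨j2, j1⟩
  · have : 0 ≤ (⌊(u - b) * l⌋₊ : ℝ) / l := by positivity
    linarith
  · have : (⌊(u - b) * l⌋₊ : ℝ) / l ≤ 1 := (div_le_one hl0).2 i1
    linarith
  · have a1 : |t - ⌊t * l⌋ / l| ≤ 1 / l := by
      rw [abs_of_nonneg (by rw [sub_nonneg, div_le_iff₀ hl0]; exact f1), sub_le_iff_le_add,
        ← add_div, le_div_iff₀ hl0]
      linarith
    have a2 : |u - (b + ⌊(u - b) * l⌋₊ / l)| ≤ 1 / l := by
      rw [← sub_sub, abs_of_nonneg (by rw [sub_nonneg, div_le_iff₀ hl0]; exact g1),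
        sub_le_iff_le_add, ← add_div, le_div_iff₀ hl0]
      linarith
    calc _ ≤ 1 / l + 1 / l := add_le_add a1 a2
      _ = _ := by ring

/-- Polynomially decaying moments and a polynomially growing Hölder modulus force almost sure
convergence to zero, simultaneously for all `t`. -/
theorem ae_forall_tendsto_zero {Y : ℝ → ℝ → Ω → ℂ}
    (hmeas : ∀ t u, 1 ≤ u → AEMeasurable (fun ω => ‖Y t u ω‖ₑ) P)
    {δ : ℝ} (hδ : 0 < δ)
    (hmom : ∀ k : ℕ, k ≠ 0 → ∃ K : ℝ≥0∞, K ≠ ∞ ∧ ∀ t u, 1 ≤ u →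
      ∫⁻ ω, ‖Y t u ω‖ₑ ^ (2 * k) ∂P ≤ ENNReal.ofReal (u ^ (-δ)) ^ k * K)
    (hmod : ∀ᵐ ω ∂P, ∃ M : ℝ≥0∞, M ≠ ∞ ∧ ∀ N t t' u u' : ℝ, 1 ≤ N → 1 ≤ u → u ≤ N → 1 ≤ u' →
      u' ≤ N → |t| ≤ N → |t'| ≤ N → ‖Y t u ω - Y t' u' ω‖ₑ ^ 2 ≤
        M * ENNReal.ofReal ((|t - t'| + |u - u'|) ^ (1 / 8 : ℝ) * N ^ 3)) :
    ∀ᵐ ω ∂P, ∀ t, Tendsto (fun u => Y t u ω) atTop (𝓝 0) := by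
  -- A grid has at most `6 (n+1)^65` points, so moments of order `(n+1)^(-67)` leave a summable
  -- `(n+1)^(-2)`.
  obtain ⟨k, hk⟩ := exists_nat_gt (67 / δ)
  have hkδ : 67 ≤ δ * k := by rw [div_lt_iff₀ hδ] at hk; linarith
  have hk0 : k ≠ 0 := by
    rintro rfl
    norm_num at hkδ
  obtain ⟨K, hK, hmom⟩ := hmom k hk0
  have hpt : ∀ n : ℕ, ∀ t u : ℝ, (n : ℝ) + 1 ≤ u → ∫⁻ ω, ‖Y t u ω‖ₑ ^ (2 * k) ∂P ≤
      ENNReal.ofReal (((n : ℝ) + 1) ^ (-67 : ℝ)) * K := by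
    intro n t u hu
    have hn0 : (0 : ℝ) ≤ n := Nat.cast_nonneg n
    have hu1 : 1 ≤ u := by linarith
    refine (hmom t u hu1).trans ?_
    gcongr
    rw [← ENNReal.ofReal_pow (by positivity), ← Real.rpow_natCast,
      ← Real.rpow_mul (by positivity)]
    refine ENNReal.ofReal_le_ofReal ?_
    calc u ^ (-δ * k) ≤ u ^ (-67 : ℝ) := Real.rpow_le_rpow_of_exponent_le hu1 (by linarith)
      _ ≤ _ := Real.rpow_le_rpow_of_nonpos (by positivity) hu (by norm_num)
  have hint : ∀ n : ℕ, ∫⁻ ω, gridSum (fun t u => ‖Y t u ω‖ₑ ^ (2 * k)) n ∂P =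
      gridSum (fun t u => ∫⁻ ω, ‖Y t u ω‖ₑ ^ (2 * k) ∂P) n := by
    intro n
    have hm (j : ℤ) (i : ℕ) : AEMeasurable (fun ω =>
        ‖Y (j / (n + 1) ^ 32) ((n + 1) + i / (n + 1) ^ 32) ω‖ₑ ^ (2 * k)) P := by
      refine (hmeas _ _ ?_).pow_const _
      have : (0 : ℝ) ≤ n + i / (n + 1) ^ 32 := by positivity
      linarith
    unfold gridSum
    rw [lintegral_finsetSum' _ fun j _ => Finset.aemeasurable_fun_sum _ fun i _ => hm j i]
    refine Finset.sum_congr rfl fun j _ => ?_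
    rw [lintegral_finsetSum' _ fun i _ => hm j i]
  have hgm : ∀ n : ℕ, AEMeasurable (fun ω => gridSum (fun t u => ‖Y t u ω‖ₑ ^ (2 * k)) n) P := by
    intro n
    refine Finset.aemeasurable_fun_sum _ fun j _ => Finset.aemeasurable_fun_sum _ fun i _ => ?_
    refine (hmeas _ _ ?_).pow_const _
    have : (0 : ℝ) ≤ n + i / (n + 1) ^ 32 := by positivity
    linarith
  have hsum : ∫⁻ ω, ∑' n, gridSum (fun t u => ‖Y t u ω‖ₑ ^ (2 * k)) n ∂P ≠ ∞ := by
    rw [lintegral_tsum hgm]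
    simp_rw [hint]
    have hle : ∀ n : ℕ, gridSum (fun t u => ∫⁻ ω, ‖Y t u ω‖ₑ ^ (2 * k) ∂P) n ≤
        ENNReal.ofReal (6 * (1 / ((n : ℝ) + 1) ^ 2)) * K := by
      intro n
      refine (gridSum_le (hpt n)).trans (le_of_eq ?_)
      rw [← mul_assoc, ← ENNReal.ofReal_mul (by positivity)]
      congr 2
      rw [Real.rpow_neg (by positivity), show (67 : ℝ) = ((67 : ℕ) : ℝ) by norm_num,
        Real.rpow_natCast]
      field_simp
    refine ne_top_of_le_ne_top ?_ (ENNReal.tsum_le_tsum hle)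
    rw [ENNReal.tsum_mul_right]
    refine ENNReal.mul_ne_top (Summable.tsum_ofReal_ne_top ?_) hK
    refine Summable.mul_left 6 ?_
    have := (summable_nat_add_iff 1).2 (Real.summable_one_div_nat_pow.2 one_lt_two)
    simpa using this
  -- The series of grid sums has finite expectation, so almost surely its terms tend to zero. The
  -- grids exhaust all times, so the null set does not depend on `t`.
  have hae := ae_lt_top' (AEMeasurable.tsum hgm) hsum
  filter_upwards [hae, hmod] with ω hω hM t
  obtain ⟨M, hMt, hM⟩ := hM
  have ha := ENNReal.tendsto_atTop_zero_of_tsum_ne_top hω.ne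
  obtain ⟨a, ha_def⟩ : ∃ a, a = gridSum (fun t u => ‖Y t u ω‖ₑ ^ (2 * k)) := ⟨_, rfl⟩
  rw [← ha_def] at ha
  rw [tendsto_zero_iff_enorm_tendsto_zero]
  have hfl : Tendsto (fun u : ℝ => ⌊u⌋₊) atTop atTop := tendsto_nat_floor_atTop
  have hfl1 : Tendsto (fun u : ℝ => ⌊u⌋₊ - 1) atTop atTop := (tendsto_sub_atTop_nat 1).comp hfl
  have l1 : Tendsto (fun u : ℝ => (a (⌊u⌋₊ - 1)) ^ (1 / (2 * k : ℕ) : ℝ)) atTop (𝓝 0) := by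
    have hk' : 0 < (1 / (2 * k : ℕ) : ℝ) := by positivity
    have := (ENNReal.continuous_rpow_const (y := (1 / (2 * k : ℕ) : ℝ))).tendsto 0
    rw [ENNReal.zero_rpow_of_pos hk'] at this
    exact this.comp (ha.comp hfl1)
  have l2 : Tendsto (fun u : ℝ => (M * ENNReal.ofReal (16 / (⌊u⌋₊ : ℝ))) ^ (1 / 2 : ℝ))
      atTop (𝓝 0) := by
    have h1 : Tendsto (fun u : ℝ => 16 / (⌊u⌋₊ : ℝ)) atTop (𝓝 0) :=
      tendsto_const_nhds.div_atTop (tendsto_natCast_atTop_atTop.comp hfl)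
    have h2 := ENNReal.Tendsto.const_mul (a := M) (ENNReal.tendsto_ofReal h1) (Or.inr hMt)
    have h3 := (ENNReal.continuous_rpow_const (y := (1 / 2 : ℝ))).tendsto 0
    rw [ENNReal.zero_rpow_of_pos (by norm_num)] at h3
    rw [ENNReal.ofReal_zero, mul_zero] at h2
    exact h3.comp h2
  have l3 := l1.add l2
  rw [add_zero] at l3
  refine tendsto_of_tendsto_of_tendsto_of_le_of_le' tendsto_const_nhds l3
    (Eventually.of_forall fun _ => zero_le) ?_
  have ev : ∀ᶠ u : ℝ in atTop, |t| ≤ (⌊u⌋₊ : ℝ) - 1 := by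
    have : Tendsto (fun u : ℝ => (⌊u⌋₊ : ℝ) - 1) atTop atTop :=
      tendsto_atTop_add_const_right _ _ (tendsto_natCast_atTop_atTop.comp hfl)
    exact this.eventually_ge_atTop _
  filter_upwards [ev, eventually_ge_atTop 1] with u ht hu
  obtain ⟨t', u', h1, h2, h3, h4, h5⟩ :=
    le_gridSum (fun t u => ‖Y t u ω‖ₑ ^ (2 * k)) ht hu
  set b : ℝ := (⌊u⌋₊ : ℝ) with hb
  have hb1 : 1 ≤ b := by
    rw [hb]; exact_mod_cast Nat.floor_pos.2 hu
  have hb0 : 0 < b := by linarith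
  have hub : u ≤ b + 1 := (Nat.lt_floor_add_one u).le
  have hd := hM (b + 1) t t' u u' (by linarith) hu hub (by linarith) h4 (by linarith) (by linarith)
  have m1 : ‖Y t' u' ω‖ₑ ≤ (a (⌊u⌋₊ - 1)) ^ (1 / (2 * k : ℕ) : ℝ) := by
    rw [one_div, ENNReal.le_rpow_inv_iff (by positivity), ENNReal.rpow_natCast]
    rw [ha_def]
    exact h1
  have m2 : ‖Y t u ω - Y t' u' ω‖ₑ ≤ (M * ENNReal.ofReal (16 / b)) ^ (1 / 2 : ℝ) := by
    rw [one_div, ENNReal.le_rpow_inv_iff (by norm_num), ENNReal.rpow_two]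
    refine hd.trans ?_
    gcongr
    -- The mesh exponent `32` is chosen here: `32 / 8 = 4` beats the growth `N³` with `N = b + 1 ≤
    -- 2b`, leaving `16 / b`.
    have e1 : (|t - t'| + |u - u'|) ^ (1 / 8 : ℝ) ≤ 2 / b ^ 4 := by
      calc _ ≤ ((2 / b ^ 4) ^ 8) ^ (1 / 8 : ℝ) := by
            gcongr
            refine h5.trans ?_
            rw [div_pow, ← pow_mul]
            gcongr
            norm_num
        _ = _ := by
            rw [← Real.rpow_natCast, ← Real.rpow_mul (by positivity)]
            norm_num
    calc _ ≤ 2 / b ^ 4 * (b + b) ^ 3 := by gcongr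
      _ = 16 / b := by field_simp; ring
  calc ‖Y t u ω‖ₑ = ‖Y t' u' ω + (Y t u ω - Y t' u' ω)‖ₑ := by rw [add_sub_cancel]
    _ ≤ _ := (enorm_add_le _ _).trans (add_le_add m1 m2)

end WaveletNoise

/-! ### Pathwise convergence of the transform and conclusion. -/

namespace WaveletNoise

/-- Cauchy–Schwarz uses a single finite quantity of the path, so one null set serves all `t` and
`s`. -/
theorem integrable_mul_waveletAtom {ψ : ℝ → ℂ} {C : ℝ} (hψ : IsAnalyticWavelet ψ)
    (hC : HatBounds ψ C) {f : ℝ → ℝ} (hf : AEStronglyMeasurable f volume)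
    (hfw : ∫⁻ τ, weight τ ^ (-(3 / 2) : ℝ) * ‖f τ‖ₑ ^ 2 < ∞) (t : ℝ) {s : ℝ} (hs : 0 < s) :
    Integrable fun τ => (f τ : ℂ) * waveletAtom ψ t s τ := by
  have hk := (integrable_waveletAtom hψ.integrable t hs).aestronglyMeasurable
  refine ⟨(Complex.continuous_ofReal.comp_aestronglyMeasurable hf).mul hk, ?_⟩
  have h := lintegral_mul_sq_le_weight hf hk
  have h2 : ∫⁻ τ, weight τ ^ (3 / 2 : ℝ) * ‖waveletAtom ψ t s τ‖ₑ ^ 2 < ∞ := by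
    calc _ ≤ ∫⁻ τ, weight τ ^ 2 * ‖waveletAtom ψ t s τ‖ₑ ^ 2 := by
          refine lintegral_mono fun τ => ?_
          gcongr
          rw [← ENNReal.rpow_two]
          exact ENNReal.rpow_le_rpow_of_exponent_le (one_le_weight τ) (by norm_num)
      _ ≤ _ := lintegral_weight_sq_atom_le ψ t hs
      _ < ∞ := ENNReal.mul_lt_top ENNReal.ofReal_lt_top (lintegral_weight_sq_lt_top hψ hC)
  rw [hasFiniteIntegral_iff_enorm]
  by_contra hcon
  rw [not_lt, top_le_iff] at hcon
  rw [hcon] at h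
  exact absurd (lt_of_le_of_lt h (ENNReal.mul_lt_top hfw h2)) (by simp)

variable {Ω : Type*} [MeasurableSpace Ω] {P : Measure Ω}

/-- The scale is reparametrised by `u → ∞` to treat both regimes together: `σ u = u⁻¹` for small
scales, `σ u = u` for large ones. `hσ` keeps the scale in `[1/N, N]` and `hσ'` transfers the modulus
from scale to `u`. -/
theorem IsCenteredNoise.ae_tendsto_integral_atom [IsFiniteMeasure P] {Z : ℝ → Ω → ℝ} {p : ℝ → ℝ}
    {V : ℝ≥0∞} (h : IsCenteredNoise P Z p V) {ψ : ℝ → ℂ} {C : ℝ} (hψ : IsAnalyticWavelet ψ)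
    (hC : HatBounds ψ C) {σ : ℝ → ℝ}
    (hσ : ∀ N u, 1 ≤ u → u ≤ N → N⁻¹ ≤ σ u ∧ σ u ≤ N)
    (hσ' : ∀ u u', 1 ≤ u → 1 ≤ u' → |σ u - σ u'| ≤ |u - u'|)
    (hvar : ∃ (δ : ℝ) (A : ℝ≥0∞), 0 < δ ∧ A ≠ ∞ ∧ ∀ u, 1 ≤ u →
      scaleVariance ψ p (σ u) ≤ ENNReal.ofReal (u ^ (-δ)) * A) :
    ∀ᵐ ω ∂P, ∀ t,
      Tendsto (fun u => ∫ τ, (Z τ ω : ℂ) * waveletAtom ψ t (σ u) τ) atTop (𝓝 0) := by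
  obtain ⟨δ, A, hδ, hA, hvar⟩ := hvar
  have hσ0 : ∀ u, 1 ≤ u → 0 < σ u := fun u hu =>
    (by positivity : 0 < u⁻¹).trans_le (hσ u u hu le_rfl).1
  refine ae_forall_tendsto_zero (δ := δ) (fun t u hu => ?_) hδ (fun k hk => ?_) ?_
  · exact (h.memLp_integral
      (integrable_waveletAtom hψ.integrable t (hσ0 u hu))).1.enorm
  · refine ⟨(2 * gaussianMomentConst (2 * k : ℕ)) ^ (2 * k) * A ^ k, ?_, fun t u hu => ?_⟩
    · have := gaussianMomentConst_ne_top (q := (2 * k : ℕ)) (ENNReal.natCast_ne_top _)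
      finiteness
    · refine (h.lintegral_pow_integral_le
        (integrable_waveletAtom hψ.integrable t (hσ0 u hu)) hk).trans ?_
      rw [lintegral_fourierHat_waveletAtom _ _ _ (hσ0 u hu), mul_left_comm, ← mul_pow]
      gcongr
      exact hvar u hu
  · obtain ⟨K, hK, hKle⟩ := exists_lintegral_weight_atom_sub_le hψ hC
    filter_upwards [ae_lintegral_weight_lt_top h.measurable h.ne_top h.second_moment] with ω hω
    have hZ : AEStronglyMeasurable (fun τ => Z τ ω) volume :=
      (h.measurable.comp (measurable_id.prodMk measurable_const)).aestronglyMeasurable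
    refine ⟨(∫⁻ τ, weight τ ^ (-(3 / 2) : ℝ) * ‖Z τ ω‖ₑ ^ 2) * K, ENNReal.mul_ne_top hω.ne hK,
      fun N t t' u u' hN hu huN hu' huN' ht ht' => ?_⟩
    have i1 := integrable_mul_waveletAtom hψ hC hZ hω t (hσ0 u hu)
    have i2 := integrable_mul_waveletAtom hψ hC hZ hω t' (hσ0 u' hu')
    rw [← integral_sub i1 i2]
    simp_rw [← mul_sub]
    refine (pow_le_pow_left' (enorm_integral_le_lintegral_enorm _) 2).trans ?_
    refine (lintegral_mul_sq_le_weight hZ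
      ((integrable_waveletAtom hψ.integrable t (hσ0 u hu)).sub
        (integrable_waveletAtom hψ.integrable t' (hσ0 u' hu'))).aestronglyMeasurable).trans ?_
    rw [mul_assoc]
    gcongr
    refine (hKle N (σ u) (σ u') t t' hN (hσ N u hu huN).1 (hσ N u hu huN).2 (hσ N u' hu' huN').1
      (hσ N u' hu' huN').2 ht ht').trans ?_
    gcongr K * ENNReal.ofReal ((|t - t'| + ?_) ^ (1 / 8 : ℝ) * N ^ 3)
    exact hσ' u u' hu hu'

theorem integral_waveletAtom_eq_zero {ψ : ℝ → ℂ} (hψ : IsAnalyticWavelet ψ) (t : ℝ) {s : ℝ}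
    (hs : 0 < s) : ∫ τ, waveletAtom ψ t s τ = 0 := by
  have h := fourierHat_waveletAtom ψ t hs 0
  rw [mul_zero, hψ.analytic 0 le_rfl, mul_zero] at h
  simpa [fourierHat] using h

/-- The wavelet transform does not see the mean of the noise. -/
theorem awt_eq_conj_integral_sub {ψ : ℝ → ℂ} (hψ : IsAnalyticWavelet ψ) {f : ℝ → ℝ} {t s : ℝ}
    (hs : 0 < s) (hf : Integrable fun τ => (f τ : ℂ) * waveletAtom ψ t s τ) (m : ℝ) :
    awt ψ f t s = (starRingEnd ℂ) (∫ τ, ((f τ - m : ℝ) : ℂ) * waveletAtom ψ t s τ) := by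
  have e : ∀ τ, awtIntegrand ψ f t s τ = (starRingEnd ℂ) ((f τ : ℂ) * waveletAtom ψ t s τ) := by
    intro τ
    rw [awtIntegrand_eq, map_mul, Complex.conj_ofReal]
  unfold awt
  simp_rw [e, Complex.ofReal_sub, sub_mul]
  rw [integral_conj, integral_sub hf ((integrable_waveletAtom hψ.integrable t hs).const_mul _),
    integral_const_mul, integral_waveletAtom_eq_zero hψ t hs, mul_zero, sub_zero]

end WaveletNoise

open WaveletNoise in
theorem mainTheorem11 {Ω : Type*} [MeasurableSpace Ω] (P : Measure Ω) [IsProbabilityMeasure P]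
    (Φ : ℝ → Ω → ℝ) (p : ℝ → ℝ) (hΦ : WaveletNoise.IsGaussianNoise P Φ p)
    (ψ : ℝ → ℂ) (hψ : WaveletNoise.IsAnalyticWavelet ψ)
    (hreg : WaveletNoise.WaveletRegularity ψ) :
    (∀ᵐ ω ∂P, ∀ t s : ℝ, 0 < s →
      Integrable (WaveletNoise.awtIntegrand ψ (fun τ => Φ τ ω) t s)) ∧
    (WaveletNoise.SpectralDecay p →
      ∀ᵐ ω ∂P, ∀ t : ℝ,
        Tendsto (fun s : ℝ => WaveletNoise.awt ψ (fun τ => Φ τ ω) t s) (𝓝[>] 0) (𝓝 0)) ∧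
    (WaveletNoise.LongRangeDependence p ∨ WaveletNoise.ShortRangeDependence p →
      ∀ᵐ ω ∂P, ∀ t : ℝ,
        Tendsto (fun s : ℝ => WaveletNoise.awt ψ (fun τ => Φ τ ω) t s) atTop (𝓝 0)) := by
  obtain ⟨C, hC⟩ := exists_hatBounds hψ hreg
  obtain ⟨V, hZ⟩ := hΦ.isCenteredNoise
  set m := ∫ ω', Φ 0 ω' ∂P with hm
  have hsecond : ∀ t, ∫⁻ ω, ‖Φ t ω‖ₑ ^ 2 ∂P = ∫⁻ ω, ‖Φ 0 ω‖ₑ ^ 2 ∂P := fun t =>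
    ((hΦ.identDistrib t).comp (u := fun x => ‖x‖ₑ ^ 2) (by fun_prop)).lintegral_eq
  have hfin : ∫⁻ ω, ‖Φ 0 ω‖ₑ ^ 2 ∂P ≠ ∞ := by
    rw [lintegral_sq_eq_eLpNorm]
    exact (ENNReal.pow_lt_top (hΦ.memLp 0).2).ne
  -- Integrability is proved for the uncentered path, which gives absolute convergence and also
  -- allows the mean to be removed under the integral.
  have hint : ∀ᵐ ω ∂P, ∀ t s : ℝ, 0 < s →
      Integrable fun τ => (Φ τ ω : ℂ) * waveletAtom ψ t s τ := by
    filter_upwards [ae_lintegral_weight_lt_top hΦ.measurable hfin hsecond] with ω hω t s hs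
    exact integrable_mul_waveletAtom hψ hC
      (hΦ.measurable.comp (measurable_id.prodMk measurable_const)).aestronglyMeasurable hω t hs
  refine ⟨?_, fun hdecay => ?_, fun hdep => ?_⟩
  · filter_upwards [hint] with ω hω t s hs
    have h1 := hω t s hs
    refine h1.mono ?_ (ae_of_all _ fun τ => by simp [awtIntegrand_eq])
    refine (Complex.continuous_conj.comp_aestronglyMeasurable h1.1).congr (ae_of_all _ fun τ => ?_)
    simp [awtIntegrand_eq]
  · have hlim := hZ.ae_tendsto_integral_atom hψ hC (σ := fun u => u⁻¹)
      (fun N u hu huN => ⟨inv_anti₀ (by linarith) huN,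
        (inv_le_one_of_one_le₀ hu).trans (hu.trans huN)⟩)
      (fun u u' hu hu' => by
        have h0 : 0 < u := by linarith
        have h0' : 0 < u' := by linarith
        rw [inv_sub_inv h0.ne' h0'.ne', abs_div, abs_sub_comm, abs_of_pos (mul_pos h0 h0')]
        exact div_le_self (abs_nonneg _) (one_le_mul_of_one_le_of_one_le hu hu'))
      (by
        obtain ⟨δ, A, hδ, hA, h⟩ :=
          exists_scaleVariance_le_of_spectralDecay hψ hC hZ.nonneg hZ.integrable hdecay
        refine ⟨δ, A, hδ, hA, fun u hu => ?_⟩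
        have h0 : 0 < u := by linarith
        have := h u⁻¹ (by positivity) (inv_le_one_of_one_le₀ hu)
        rwa [Real.inv_rpow h0.le, ← Real.rpow_neg h0.le] at this)
    filter_upwards [hint, hlim] with ω hω hl t
    have h1 := ((Complex.continuous_conj.tendsto 0).comp
      ((hl t).comp tendsto_inv_nhdsGT_zero))
    rw [map_zero] at h1
    refine h1.congr' ?_
    filter_upwards [self_mem_nhdsWithin] with s hs
    rw [awt_eq_conj_integral_sub hψ hs (hω t s hs) m]
    simp
  · have hlow : ∃ (δ : ℝ) (A : ℝ≥0∞), 0 < δ ∧ A ≠ ∞ ∧ ∀ x, 0 < x → x ≤ 1 →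
        lowMass p x ≤ ENNReal.ofReal (x ^ δ) * A :=
      hdep.elim (exists_lowMass_le_of_longRange hZ.integrable) exists_lowMass_le_of_shortRange
    have hlim := hZ.ae_tendsto_integral_atom hψ hC (σ := fun u => u)
      (fun N u hu huN => ⟨(inv_le_one_of_one_le₀ (hu.trans huN)).trans hu, huN⟩)
      (fun u u' _ _ => le_rfl) (exists_scaleVariance_le_of_lowMass hC hZ.integrable hlow)
    filter_upwards [hint, hlim] with ω hω hl t
    have h1 := (Complex.continuous_conj.tendsto 0).comp (hl t)
    rw [map_zero] at h1
    refine h1.congr' ?_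
    filter_upwards [eventually_gt_atTop 0] with s hs
    rw [awt_eq_conj_integral_sub hψ hs (hω t s hs) m]
    simp
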